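/- Let $\ell^2$ be the complex Hilbert space of square-summable sequences $\mathbf z=(z_j)_{j\ge1}=(x_j+\sqrt{-1}\,y_j)_{j\ge1}$ of complex numbers. Fix positive numbers $a_1,a_2,\dots$ with $\sum_i a_i<1$, and let $P$ be the Borel probability measure on $\ell^2$ obtained by restricting to $\ell^2$ the product measure $\prod_{i\ge1}\frac{1}{2\pi a_i^2}e^{-(x_i^2+y_i^2)/(2a_i^2)}\,dx_i\,dy_i$ on $\mathbb C^{\infty}$ (for which $\ell^2$ has measure one). Partial derivatives $\partial/\partial x_j$ and $\partial/\partial y_j$ of functions $g:\ell^2\to\mathbb C$ are taken in the usual sense along the coordinate directions; $\partial_j=\frac12\left(\frac{\partial}{\partial x_j}-\sqrt{-1}\frac{\partial}{\partial y_j}\right)$, $\overline\partial_j=\frac12\left(\frac{\partial}{\partial x_j}+\sqrt{-1}\frac{\partial}{\partial y_j}\right)$, and for finitely supported multi-indices $\alpha,\beta$ of nonnegative integers $\partial_\alpha=\partial_1^{\alpha_1}\partial_2^{\alpha_2}\cdots$, $\overline\partial_\beta=\overline\partial_1^{\beta_1}\overline\partial_2^{\beta_2}\cdots$. For $k\in\mathbb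 N$, $C^k(\ell^2)$ is the set of functions $g:\ell^2\to\mathbb C$ such that $g$ and all its partial derivatives (with respect to the $x_j$ and $y_j$) up to order $k$ exist and are continuous on $\ell^2$, and $C^\infty(\ell^2)=\bigcap_k C^k(\ell^2)$. Further: * $C^\infty_0(\ell^2)$ is the set of $g\in C^\infty(\ell^2)$ with bounded support such that $\sup_{\ell^2}|\partial_\alpha\overline\partial_\beta g|<\infty$ for all $\alpha,\beta$; * $C^1_F(\ell^2)$ is the set of $g\in C^1(\ell^2)$ with $\sup_S\big\{|g|+\sum_{j=1}^\infty(|\partial_jg|^2+|\overline\partial_jg|^2)\big\}<\infty$ for every bounded $S\subset\ell^2$; * $C^\infty_{F^\infty}(\ell^2)$ is the set of $g\in C^\infty(\ell^2)$ with $\partial_\alpha\overline\partial_\beta g\in C^1_F(\ell^2)$ for all $\alpha,\beta$; * $\mathrm{Lip}(\ell^2)$ is the set of $g:\ell^2\to\mathbb C$ that are Lipschitz on every bounded subset of $\ell^2$. (The bounded sets are precisely the sets that are uniformly included in $\ell^2$: a bounded $S\subset V$ is uniformly included in an open set $V$ if $d(S,\partial V)>0$, where $d(S,\partial V)=+\infty$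 for $V=\ell^2$.) **Theorem.** Let $\vartheta\in C^\infty_0(\ell^2)$ and $f\in\mathrm{Lip}(\ell^2)$. For every $\varepsilon>0$ the integral $$f_\varepsilon(\mathbf z)=\int_{\ell^2}f(\mathbf z-\varepsilon\zeta)\,\vartheta(\zeta)\,dP(\zeta),\qquad \mathbf z\in\ell^2,$$ converges absolutely for every $\mathbf z$, and $f_\varepsilon\in C^\infty_{F^\infty}(\ell^2)$. Moreover, if $\int_{\ell^2}\vartheta\,dP=1$, then $f_\varepsilon(\mathbf z)\to f(\mathbf z)$ as $\varepsilon\to0^+$ for every $\mathbf z\in\ell^2$. -/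

import Mathlib

open MeasureTheory ProbabilityTheory Filter Topology

noncomputable section

namespace EllTwo

/-- The complex Hilbert space `ℓ²` of square summable complex sequences
(coordinates are numbered `0, 1, 2, …`). -/
abbrev Ell2 : Type := lp (fun _ : ℕ => ℂ) 2

/-- `ℓ²` carries its Borel σ-algebra (of the norm topology). -/
instance instMeasurableSpaceEll2 : MeasurableSpace Ell2 := borel Ell2

instance instBorelSpaceEll2 : BorelSpace Ell2 := ⟨rfl⟩

/-! ### The Gaussian measure -/

/-- The measure `(2πa²)⁻¹ exp(-(x² + y²)/(2a²)) dx dy` on `ℂ = ℝ²`: real and imaginary part are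
independent, centred Gaussian variables with variance `a²`. -/
def gaussianComplex (a : ℝ) : Measure ℂ :=
  ((gaussianReal 0 (Real.toNNReal (a ^ 2))).prod (gaussianReal 0 (Real.toNNReal (a ^ 2)))).map
    Complex.measurableEquivRealProd.symm

/-- The product measure `𝒩 = ∏ᵢ (2πaᵢ²)⁻¹ exp(-(xᵢ² + yᵢ²)/(2aᵢ²)) dxᵢ dyᵢ` on `ℂ^∞`. -/
def gaussianSeq (a : ℕ → ℝ) : Measure (ℕ → ℂ) :=
  Measure.infinitePi fun i => gaussianComplex (a i)

/-- `ℓ²` is separable. -/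
theorem separableSpace_ell2 : TopologicalSpace.SeparableSpace Ell2 := by
  rw [← TopologicalSpace.isSeparable_univ_iff]
  have h : TopologicalSpace.IsSeparable
      (closure (Submodule.span ℂ
        (Set.range fun i : ℕ => (lp.single 2 i (1 : ℂ) : Ell2)) : Set Ell2)) :=
    (((Set.countable_range _).isSeparable).span (R := ℂ)).closure
  refine h.mono fun z _ => ?_
  have hz := lp.hasSum_single (p := 2) (by simp) z
  refine mem_closure_of_tendsto hz (Eventually.of_forall fun s => ?_)
  refine Submodule.sum_mem _ fun i _ => ?_
  have : lp.single 2 i (z i) = (z i) • (lp.single 2 i (1 : ℂ) : Ell2) := by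
    rw [← lp.single_smul]; simp
  rw [this]
  exact Submodule.smul_mem _ _ (Submodule.subset_span ⟨i, rfl⟩)

/-- `ℓ²` is a Borel subset of `ℂ^∞` and its Borel σ-algebra is the trace of that of `ℂ^∞`, so that
the measure `gaussianEll2` below is well defined. -/
theorem measurableEmbedding_coe : MeasurableEmbedding fun z : Ell2 => (z : ℕ → ℂ) := by
  have := separableSpace_ell2
  have : SecondCountableTopology Ell2 := UniformSpace.secondCountable_of_separable _
  have : PolishSpace Ell2 := inferInstance
  exact Continuous.measurableEmbedding (lp.uniformContinuous_coe).continuous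
    Subtype.coe_injective

/-- The Borel measure `P` on `ℓ²`: for a Borel set `E` of `ℓ²`, `P(E)` is the `𝒩`-measure of `E`
regarded as a (Borel) subset of `ℂ^∞`. -/
def gaussianEll2 (a : ℕ → ℝ) : Measure Ell2 :=
  (gaussianSeq a).comap fun z : Ell2 => (z : ℕ → ℂ)

/-! ### Uniform inclusion and Lipschitz functions -/

/-- `d(S, ∂V)`, the infimum of `‖z - w‖` over `z ∈ S` and `w ∈ ∂V`; it is `∞` if `V = ℓ²`
since then `∂V` is empty. -/
def distBoundary (S V : Set Ell2) : ENNReal :=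
  ⨅ z ∈ S, ⨅ w ∈ frontier V, edist z w

/-- `S` is uniformly included in `V`: it is a bounded subset of `V` with `d(S, ∂V) > 0`. -/
def UniformlyIncluded (S V : Set Ell2) : Prop :=
  S ⊆ V ∧ Bornology.IsBounded S ∧ 0 < distBoundary S V

/-- The class `Lip(V)`. -/
def LipOn (V : Set Ell2) (f : Ell2 → ℂ) : Prop :=
  ∀ S : Set Ell2, UniformlyIncluded S V →
    ∃ C : ℝ, 0 < C ∧ ∀ z ∈ S, ∀ w ∈ S, ‖f z - f w‖ ≤ C * ‖z - w‖

/-! ### Partial derivatives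

Functions on an open set `V` are represented by functions on `ℓ²`, of which only the values on `V`
matter. -/

/-- The function `τ ↦ f(z₀, …, z_{j-1}, z_j + τ u, z_{j+1}, …)` of the real variable `τ`. -/
def slice (u : ℂ) (j : ℕ) (f : Ell2 → ℂ) (z : Ell2) (τ : ℝ) : ℂ :=
  f (z + lp.single 2 j ((τ : ℂ) * u))

/-- The partial derivative of `f` in the `j`-th coordinate, in the real direction `u ∈ ℂ`:
`u = 1` gives `∂f/∂x_j` and `u = √-1` gives `∂f/∂y_j`. -/
def partialDeriv (u : ℂ) (j : ℕ) (f : Ell2 → ℂ) (z : Ell2) : ℂ :=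
  deriv (slice u j f z) 0

/-- Existence of the limit that defines `partialDeriv u j f z`. -/
def HasPartial (u : ℂ) (j : ℕ) (f : Ell2 → ℂ) (z : Ell2) : Prop :=
  DifferentiableAt ℝ (slice u j f z) 0

/-- `C^k(V)`: all partial derivatives (with respect to the `x_j` and `y_j`, in any order)
up to order `k` exist and are continuous on `V`. -/
def ContDiffPartial (V : Set Ell2) : ℕ → (Ell2 → ℂ) → Prop
  | 0, f => ContinuousOn f V
  | k + 1, f => ContinuousOn f V ∧
      ∀ u ∈ ({1, Complex.I} : Set ℂ), ∀ j : ℕ,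
        (∀ z ∈ V, HasPartial u j f z) ∧ ContDiffPartial V k (partialDeriv u j f)

/-- `C^∞(V)`. -/
def SmoothPartial (V : Set Ell2) (f : Ell2 → ℂ) : Prop :=
  ∀ k : ℕ, ContDiffPartial V k f

/-- `∂_j = (∂/∂x_j - √-1 ∂/∂y_j) / 2`. -/
def del (j : ℕ) (f : Ell2 → ℂ) (z : Ell2) : ℂ :=
  (1 / 2) * (partialDeriv 1 j f z - Complex.I * partialDeriv Complex.I j f z)

/-- `∂̄_j = (∂/∂x_j + √-1 ∂/∂y_j) / 2`. -/
def delBar (j : ℕ) (f : Ell2 → ℂ) (z : Ell2) : ℂ :=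
  (1 / 2) * (partialDeriv 1 j f z + Complex.I * partialDeriv Complex.I j f z)

/-- For operators `D 0, D 1, …` and a finitely supported multi-index `α`, the composition
`(D 0)^{α 0} (D 1)^{α 1} ⋯ (D (n-1))^{α (n-1)}`, where `α j = 0` for all `j ≥ n`. -/
def multiOp (D : ℕ → (Ell2 → ℂ) → Ell2 → ℂ) (α : ℕ →₀ ℕ) (f : Ell2 → ℂ) : Ell2 → ℂ :=
  (List.range (α.support.sup Nat.succ)).foldr (fun j g => (D j)^[α j] g) f

/-- `∂_α ∂̄_β f`. -/
def delDelBar (α β : ℕ →₀ ℕ) (f : Ell2 → ℂ) : Ell2 → ℂ :=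
  multiOp del α (multiOp delBar β f)

/-! ### Function spaces -/

/-- `C^1_F(V)`: functions in `C^1(V)` for which `|f| + ∑_j (|∂_j f|² + |∂̄_j f|²)` is bounded on
each set that is uniformly included in `V`. -/
def C1F (V : Set Ell2) (f : Ell2 → ℂ) : Prop :=
  ContDiffPartial V 1 f ∧
    ∀ S : Set Ell2, UniformlyIncluded S V → ∃ C : ℝ, ∀ z ∈ S,
      Summable (fun j : ℕ => ‖del j f z‖ ^ 2 + ‖delBar j f z‖ ^ 2) ∧
      ‖f z‖ + ∑' j : ℕ, (‖del j f z‖ ^ 2 + ‖delBar j f z‖ ^ 2) ≤ C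

/-- `C^∞_{F^∞}(V)`: functions in `C^∞(V)` all of whose derivatives `∂_α ∂̄_β f` are in
`C^1_F(V)`. -/
def CInftyFInfty (V : Set Ell2) (f : Ell2 → ℂ) : Prop :=
  SmoothPartial V f ∧ ∀ α β : ℕ →₀ ℕ, C1F V (delDelBar α β f)

/-- `C^∞_0(V)`: functions in `C^∞(V)` with support uniformly included in `V` and all derivatives
`∂_α ∂̄_β f` bounded on `V`. -/
def CInftyZero (V : Set Ell2) (f : Ell2 → ℂ) : Prop :=
  SmoothPartial V f ∧
    UniformlyIncluded (closure {z : Ell2 | z ∈ V ∧ f z ≠ 0}) V ∧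
    ∀ α β : ℕ →₀ ℕ, ∃ C : ℝ, ∀ z ∈ V, ‖delDelBar α β f z‖ ≤ C

/-! ### The mollification -/

/-- `f_ε(z) = ∫ f(z - εζ) ϑ(ζ) dP(ζ)`, where `P` is the Gaussian measure with parameters `a`. -/
def mollify (a : ℕ → ℝ) (ϑ f : Ell2 → ℂ) (ε : ℝ) (z : Ell2) : ℂ :=
  ∫ ζ, f (z - (ε : ℂ) • ζ) * ϑ ζ ∂(gaussianEll2 a)

end EllTwo

end

/-! Since `f` is only Lipschitz, every derivative of `f_ε` has to be moved onto the kernel. Lebesgue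
measure being absent on ℓ², this rests on the quasi-invariance of `P` along coordinates: a shift by
`c` in the `j`-th coordinate affects one Gaussian factor and costs an explicit exponential density
(Cameron–Martin). Substituting `ζ ↦ ζ + (t/ε)e` in `f_ε(z + te)` makes `f(z - εζ)` independent of
`t`. Differentiating what remains gives `ε⁻¹` times the mollification of `f` with kernel `∂_u ϑ -
(x_u / a_j²) ϑ` (`LipOn.hasLineDerivAt_mollify`). Bounded support keeps the linear factor `x_u`
bounded, so the new kernel is again a test function, and by iteration every derivative of `f_ε` is a
mollification of `f` itself.

It therefore suffices to treat one mollification. It is Lipschitz on bounded sets because `f` is,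
hence continuous and locally bounded. Square summability of its gradient is Bessel's inequality
(`sum_sq_norm_lineDeriv_le`): continuity of the partial derivatives makes the derivative additive in
the direction, the Lipschitz constant bounds it in every direction, and the direction of the
gradient itself gives the estimate.

The hypothesis on `ϑ` bounds `∂_α ∂̄_β ϑ` in one fixed order of the operators, while the iteration
needs real partial derivatives in any order. Symmetry of continuous second derivatives makes the
operators commute and bridges this gap (`CInftyZero.exists_testFn`). The limit `ε → 0⁺` is dominated
convergence. -/

noncomputable section

namespace EllTwo


/-! ### Continuous line derivatives: additivity, symmetry, Bessel's inequality -/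

section LineDeriv

variable {E : Type*} [NormedAddCommGroup E] [NormedSpace ℝ E]

theorem hasDerivAt_add_smul_of_hasLineDerivAt {g g' : E → ℂ} {v : E}
    (hv : ∀ z, HasLineDerivAt ℝ g (g' z) z v) (z : E) (t : ℝ) :
    HasDerivAt (fun t : ℝ => g (z + t • v)) (g' (z + t • v)) t := by
  have h : HasDerivAt (fun s : ℝ => g ((z + t • v) + s • v)) (g' (z + t • v)) (t - t) := by
    rw [sub_self]; exact hv (z + t • v)
  have h2 := h.comp_sub_const t t
  refine h2.congr_of_eventuallyEq (Eventually.of_forall fun s => ?_)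
  simp only [sub_smul]
  congr 1
  abel

/-- A function with continuous line derivatives along `v` and `w` is differentiable on the planes
spanned by `v` and `w`. -/
theorem hasFDerivAt_plane {g gv gw : E → ℂ} {v w : E}
    (hv : ∀ z, HasLineDerivAt ℝ g (gv z) z v) (hw : ∀ z, HasLineDerivAt ℝ g (gw z) z w)
    (cv : Continuous gv) (cw : Continuous gw) (z : E) (p : ℝ × ℝ) :
    HasFDerivAt (fun p : ℝ × ℝ => g (z + p.1 • v + p.2 • w))
      ((ContinuousLinearMap.toSpanSingleton ℝ (gv (z + p.1 • v + p.2 • w))).coprod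
        (ContinuousLinearMap.toSpanSingleton ℝ (gw (z + p.1 • v + p.2 • w)))) p := by
  have c : Continuous fun p : ℝ × ℝ => z + p.1 • v + p.2 • w := by fun_prop
  refine (hasStrictFDerivAt_uncurry_coprod (𝕜 := ℝ) (u := p)
    (f := fun s t : ℝ => g (z + s • v + t • w))
    (f₁ := fun s t => ContinuousLinearMap.toSpanSingleton ℝ (gv (z + s • v + t • w)))
    (f₂ := fun s t => ContinuousLinearMap.toSpanSingleton ℝ (gw (z + s • v + t • w)))
    (Eventually.of_forall fun q => ?_) (Eventually.of_forall fun q => ?_) ?_ ?_).hasFDerivAt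
  · have := (hasDerivAt_add_smul_of_hasLineDerivAt hv (z + q.2 • w) q.1).hasFDerivAt
    have e : ∀ s : ℝ, z + q.2 • w + s • v = z + s • v + q.2 • w := fun s => by abel
    simp only [e] at this
    exact this
  · exact (hasDerivAt_add_smul_of_hasLineDerivAt hw (z + q.1 • v) q.2).hasFDerivAt
  · exact ((ContinuousLinearMap.toSpanSingletonCLE (𝕜 := ℝ) (E := ℂ)).continuous.comp
      (cv.comp c)).continuousAt
  · exact ((ContinuousLinearMap.toSpanSingletonCLE (𝕜 := ℝ) (E := ℂ)).continuous.comp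
      (cw.comp c)).continuousAt

/-- Line derivatives alone need not be additive in the direction. Continuity gives differentiability
on the plane through `z`, and the chain rule along its diagonal gives the sum. -/
theorem hasLineDerivAt_add_of_continuous {g gv gw : E → ℂ} {v w : E}
    (hv : ∀ z, HasLineDerivAt ℝ g (gv z) z v) (hw : ∀ z, HasLineDerivAt ℝ g (gw z) z w)
    (cv : Continuous gv) (cw : Continuous gw) (z : E) :
    HasLineDerivAt ℝ g (gv z + gw z) z (v + w) := by
  have h := hasFDerivAt_plane hv hw cv cw z (0, 0)
  have hd : HasDerivAt (fun t : ℝ => (t, t)) ((1 : ℝ), (1 : ℝ)) 0 :=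
    (hasDerivAt_id 0).prodMk (hasDerivAt_id 0)
  have := HasFDerivAt.comp_hasDerivAt (f := fun t : ℝ => (t, t)) (0 : ℝ) h hd
  have e : ∀ t : ℝ, z + t • v + t • w = z + t • (v + w) := fun t => by rw [smul_add, add_assoc]
  simpa [HasLineDerivAt, Function.comp_def, e] using this

theorem hasLineDerivAt_sum_of_continuous {ι : Type*} {g : E → ℂ} {g' : ι → E → ℂ} {v : ι → E}
    (hv : ∀ i z, HasLineDerivAt ℝ g (g' i z) z (v i)) (cv : ∀ i, Continuous (g' i))
    (c : ι → ℝ) (s : Finset ι) (z : E) :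
    HasLineDerivAt ℝ g (∑ i ∈ s, c i • g' i z) z (∑ i ∈ s, c i • v i) := by
  classical
  induction s using Finset.induction_on generalizing z with
  | empty => simp [HasLineDerivAt, hasDerivAt_const]
  | insert i s hi ih =>
    simp only [Finset.sum_insert hi]
    exact hasLineDerivAt_add_of_continuous (gv := fun z => c i • g' i z)
      (gw := fun z => ∑ i ∈ s, c i • g' i z) (fun z => (hv i z).smul (c i)) ih
      (by have := cv i; fun_prop)
      (by fun_prop) z

/-- Symmetry of continuous second line derivatives. -/
theorem lineDeriv_comm {g gv gw gvv gvw gwv gww : E → ℂ} {v w : E}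
    (hv : ∀ z, HasLineDerivAt ℝ g (gv z) z v) (hw : ∀ z, HasLineDerivAt ℝ g (gw z) z w)
    (hvv : ∀ z, HasLineDerivAt ℝ gv (gvv z) z v) (hvw : ∀ z, HasLineDerivAt ℝ gv (gvw z) z w)
    (hwv : ∀ z, HasLineDerivAt ℝ gw (gwv z) z v) (hww : ∀ z, HasLineDerivAt ℝ gw (gww z) z w)
    (cv : Continuous gv) (cw : Continuous gw) (cvv : Continuous gvv) (cvw : Continuous gvw)
    (cwv : Continuous gwv) (cww : Continuous gww) (z : E) : gvw z = gwv z := by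
  have h := hasFDerivAt_plane hv hw cv cw z
  have h1 := hasFDerivAt_plane hvv hvw cvv cvw z 0
  have h2 := hasFDerivAt_plane hwv hww cwv cww z 0
  have k1 := ((ContinuousLinearMap.toSpanSingletonCLE
    (𝕜 := ℝ) (E := ℂ)).toContinuousLinearMap.hasFDerivAt.comp (0 : ℝ × ℝ) h1)
  have k2 := ((ContinuousLinearMap.toSpanSingletonCLE
    (𝕜 := ℝ) (E := ℂ)).toContinuousLinearMap.hasFDerivAt.comp (0 : ℝ × ℝ) h2)
  -- The Fréchet derivative of `p ↦ g (z + p.1 • v + p.2 • w)` is itself differentiable at the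
  -- origin, so the classical symmetry theorem in the plane applies.
  have k := (k1.clm_comp (hasFDerivAt_const (ContinuousLinearMap.fst ℝ ℝ ℝ) 0)).add
    (k2.clm_comp (hasFDerivAt_const (ContinuousLinearMap.snd ℝ ℝ ℝ) 0))
  have e : ∀ x y : ℂ, (ContinuousLinearMap.toSpanSingleton ℝ x).coprod
      (ContinuousLinearMap.toSpanSingleton ℝ y) =
      (ContinuousLinearMap.toSpanSingleton ℝ x).comp (ContinuousLinearMap.fst ℝ ℝ ℝ) +
      (ContinuousLinearMap.toSpanSingleton ℝ y).comp (ContinuousLinearMap.snd ℝ ℝ ℝ) := by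
    intro x y; ext <;> simp
  have := second_derivative_symmetric (𝕜 := ℝ)
    (f' := fun p : ℝ × ℝ => (ContinuousLinearMap.toSpanSingleton ℝ
      (gv (z + p.1 • v + p.2 • w))).comp (ContinuousLinearMap.fst ℝ ℝ ℝ) +
      (ContinuousLinearMap.toSpanSingleton ℝ
      (gw (z + p.1 • v + p.2 • w))).comp (ContinuousLinearMap.snd ℝ ℝ ℝ))
    (fun p => by rw [← e]; exact h p) k (0, 1) (1, 0)
  simpa using this

/-- Bessel's inequality for the line derivatives of a Lipschitz function along an orthonormal
family. -/
theorem sum_sq_norm_lineDeriv_le {ι : Type*} {g : E → ℂ} {g' : ι → E → ℂ} {v : ι → E}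
    (hv : ∀ i z, HasLineDerivAt ℝ g (g' i z) z (v i)) (cv : ∀ i, Continuous (g' i))
    (s : Finset ι) (ho : ∀ c : ι → ℝ, ‖∑ i ∈ s, c i • v i‖ ^ 2 ≤ ∑ i ∈ s, c i ^ 2)
    {z : E} {t : Set E} (ht : t ∈ 𝓝 z) {C : NNReal} (hC : LipschitzOnWith C g t) :
    ∑ i ∈ s, ‖g' i z‖ ^ 2 ≤ 2 * (C : ℝ) ^ 2 := by
  -- Directions carry real coefficients, so complex values are tested through real functionals; the
  -- real and imaginary parts each contribute `C²`, whence the factor 2.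
  have key : ∀ φ : ℂ → ℝ, (∀ (r : ℝ) x, φ (r • x) = r * φ x) → (∀ x y, φ (x + y) = φ x + φ y) →
      (∀ x, |φ x| ≤ ‖x‖) → ∑ i ∈ s, φ (g' i z) ^ 2 ≤ (C : ℝ) ^ 2 := by
    intro φ h1 h2 h3
    set S := ∑ i ∈ s, φ (g' i z) ^ 2 with hS
    have hS0 : 0 ≤ S := Finset.sum_nonneg fun i _ => sq_nonneg _
    -- The direction is the gradient of `φ ∘ g` along the family: there the derivative of `φ ∘ g` is
    -- `S`, while the direction has norm at most `√S`.
    have hd := hasLineDerivAt_sum_of_continuous hv cv (fun i => φ (g' i z)) s z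
    have hb := hd.le_of_lipschitzOn ht hC
    have hφ0 : φ 0 = 0 := by simpa using h1 0 0
    have hsum : φ (∑ i ∈ s, φ (g' i z) • g' i z) = S := by
      let ψ : ℂ →+ ℝ := ⟨⟨φ, hφ0⟩, h2⟩
      change ψ _ = S
      rw [map_sum]
      exact Finset.sum_congr rfl fun i _ => by rw [sq]; exact h1 _ _
    have h4 := h3 (∑ i ∈ s, φ (g' i z) • g' i z)
    rw [hsum, abs_of_nonneg hS0] at h4
    have h5 := ho fun i => φ (g' i z)
    have h6 : S ^ 2 ≤ (C : ℝ) ^ 2 * S := by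
      calc S ^ 2 ≤ (C * ‖∑ i ∈ s, φ (g' i z) • v i‖) ^ 2 :=
            pow_le_pow_left₀ hS0 (h4.trans hb) 2
        _ = (C : ℝ) ^ 2 * ‖∑ i ∈ s, φ (g' i z) • v i‖ ^ 2 := by ring
        _ ≤ _ := mul_le_mul_of_nonneg_left h5 (by positivity)
    rcases hS0.eq_or_lt with h0 | h0
    · rw [← h0]; positivity
    · exact le_of_mul_le_mul_right (by rw [← sq]; exact h6) h0
  have hre := key Complex.re (by simp) (by simp) Complex.abs_re_le_norm
  have him := key Complex.im (by simp) (by simp) Complex.abs_im_le_norm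
  have : ∀ x : ℂ, ‖x‖ ^ 2 = x.re ^ 2 + x.im ^ 2 := fun x => by
    rw [← Complex.normSq_eq_norm_sq, Complex.normSq_apply]; ring
  simp only [this, Finset.sum_add_distrib]
  linarith

end LineDeriv


/-! ### Gaussian measures under translation in one coordinate -/

/-- The density appearing when the Gaussian of standard deviation `a` is translated by `c`. -/
def shiftDensity (a : ℝ) (c w : ℂ) : ℝ :=
  Real.exp (-((w.re * c.re + w.im * c.im) / a ^ 2) - (c.re ^ 2 + c.im ^ 2) / (2 * a ^ 2))

theorem continuous_shiftDensity (a : ℝ) (c : ℂ) : Continuous (shiftDensity a c) := by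
  unfold shiftDensity
  fun_prop

theorem shiftDensity_nonneg (a : ℝ) (c w : ℂ) : 0 ≤ shiftDensity a c w := Real.exp_nonneg _

theorem measurable_ofReal_shiftDensity (a : ℝ) (c : ℂ) :
    Measurable fun w => ENNReal.ofReal (shiftDensity a c w) :=
  (continuous_shiftDensity a c).measurable.ennreal_ofReal

/-- Completing the square: the density turns the centred Gaussian into the one with mean `-c`, which
the translation recentres. -/
theorem gaussianReal_withDensity_map_add {a : ℝ} (ha : 0 < a) (c : ℝ) :
    ((gaussianReal 0 (Real.toNNReal (a ^ 2))).withDensity fun x =>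
      ENNReal.ofReal (Real.exp (-(x * c / a ^ 2) - c ^ 2 / (2 * a ^ 2)))).map (· + c) =
      gaussianReal 0 (Real.toNNReal (a ^ 2)) := by
  have hv : Real.toNNReal (a ^ 2) ≠ 0 := by
    rw [Ne, Real.toNNReal_eq_zero, not_le]; positivity
  have : ((gaussianReal 0 (Real.toNNReal (a ^ 2))).withDensity fun x =>
      ENNReal.ofReal (Real.exp (-(x * c / a ^ 2) - c ^ 2 / (2 * a ^ 2)))) =
      gaussianReal (-c) (Real.toNNReal (a ^ 2)) := by
    rw [gaussianReal_of_var_ne_zero _ hv, gaussianReal_of_var_ne_zero _ hv,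
      ← withDensity_mul _ (measurable_gaussianPDF _ _) (by fun_prop)]
    congr 1
    ext x
    rw [Pi.mul_apply, gaussianPDF, gaussianPDF,
      ← ENNReal.ofReal_mul (gaussianPDFReal_nonneg _ _ _), gaussianPDFReal, gaussianPDFReal,
      mul_assoc, ← Real.exp_add, Real.coe_toNNReal _ (sq_nonneg a)]
    congr 3
    field_simp
    ring
  rw [this, gaussianReal_map_add_const, neg_add_cancel]

instance isProbabilityMeasure_gaussianComplex (a : ℝ) :
    IsProbabilityMeasure (gaussianComplex a) :=
  Measure.isProbabilityMeasure_map (MeasurableEquiv.measurable _).aemeasurable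

theorem gaussianComplex_withDensity_map_add {a : ℝ} (ha : 0 < a) (c : ℂ) :
    ((gaussianComplex a).withDensity fun w => ENNReal.ofReal (shiftDensity a c w)).map (· + c) =
      gaussianComplex a := by
  set γ := gaussianReal 0 (Real.toNNReal (a ^ 2)) with hγ
  set ρ : ℝ → ℝ → ENNReal := fun d x =>
    ENNReal.ofReal (Real.exp (-(x * d / a ^ 2) - d ^ 2 / (2 * a ^ 2))) with hρ
  have hρm : ∀ d, Measurable (ρ d) := fun d => by simp only [hρ]; fun_prop
  have hprod : (γ.prod γ).withDensity (fun p => ρ c.re p.1 * ρ c.im p.2) =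
      (γ.withDensity (ρ c.re)).prod (γ.withDensity (ρ c.im)) :=
    (prod_withDensity (hρm _) (hρm _)).symm
  have hden : (gaussianComplex a).withDensity (fun w => ENNReal.ofReal (shiftDensity a c w)) =
      ((γ.prod γ).withDensity (fun p => ρ c.re p.1 * ρ c.im p.2)).map
        Complex.measurableEquivRealProd.symm := by
    ext s hs
    rw [withDensity_apply _ hs, gaussianComplex,
      setLIntegral_map hs (measurable_ofReal_shiftDensity a c) (MeasurableEquiv.measurable _),
      Measure.map_apply (MeasurableEquiv.measurable _) hs,
      withDensity_apply _ (MeasurableEquiv.measurable _ hs)]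
    refine lintegral_congr fun p => ?_
    simp only [hρ]
    rw [← ENNReal.ofReal_mul (Real.exp_nonneg _), ← Real.exp_add, shiftDensity]
    congr 2
    simp only [Complex.measurableEquivRealProd_symm_apply]
    ring
  rw [hden, hprod, Measure.map_map (by fun_prop) (MeasurableEquiv.measurable _)]
  have hcomp : (fun w : ℂ => w + c) ∘ Complex.measurableEquivRealProd.symm =
      Complex.measurableEquivRealProd.symm ∘ Prod.map (· + c.re) (· + c.im) := by
    funext p
    apply Complex.ext <;> simp [Complex.measurableEquivRealProd_symm_apply]
  rw [hcomp, ← Measure.map_map (MeasurableEquiv.measurable _) (by fun_prop),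
    ← Measure.map_prod_map _ _ (by fun_prop) (by fun_prop),
    gaussianReal_withDensity_map_add ha, gaussianReal_withDensity_map_add ha]
  rfl

instance isProbabilityMeasure_gaussianSeq (a : ℕ → ℝ) : IsProbabilityMeasure (gaussianSeq a) := by
  unfold gaussianSeq; infer_instance

/-- Reweighting one factor of an infinite product measure. -/
theorem infinitePi_update_withDensity {ι : Type*} [DecidableEq ι] {X : ι → Type*}
    [∀ i, MeasurableSpace (X i)] (μ : ∀ i, Measure (X i)) [∀ i, IsProbabilityMeasure (μ i)]
    (j : ι) {ρ : X j → ENNReal} (hρ : Measurable ρ)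
    [∀ i, IsProbabilityMeasure (Function.update μ j ((μ j).withDensity ρ) i)] :
    Measure.infinitePi (Function.update μ j ((μ j).withDensity ρ)) =
      (Measure.infinitePi μ).withDensity fun x => ρ (x j) := by
  symm
  refine Measure.eq_infinitePi _ fun s t ht => ?_
  -- The box is split into its constraint on coordinate `j` (void if `j ∉ s`) and the constraints
  -- `B` on the other coordinates.
  set T : Set (X j) := if j ∈ s then t j else Set.univ with hT
  have hTm : MeasurableSet T := by
    rw [hT]; split_ifs; exacts [ht j, MeasurableSet.univ]
  set B : Set (∀ i, X i) := (↑(s.erase j) : Set ι).pi t with hB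
  have hBm : MeasurableSet B := MeasurableSet.pi (Finset.countable_toSet _) fun i _ => ht i
  have hbox : (↑s : Set ι).pi t = (fun x : ∀ i, X i => x j) ⁻¹' T ∩ B := by
    ext x
    simp only [Set.mem_pi, Set.mem_inter_iff, Set.mem_preimage, hT, hB, Finset.mem_coe,
      Finset.mem_erase]
    by_cases hj : j ∈ s
    · simp only [hj, if_true]
      refine ⟨fun h => ⟨h j hj, fun i hi => h i hi.2⟩, fun h i hi => ?_⟩
      rcases eq_or_ne i j with rfl | hij
      · exact h.1
      · exact h.2 i ⟨hij, hi⟩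
    · simp only [hj, if_false, Set.mem_univ, true_and]
      exact ⟨fun h i hi => h i hi.2, fun h i hi => h i ⟨fun e => hj (e ▸ hi), hi⟩⟩
  -- Independence: `B` does not involve coordinate `j`, so restricting to `B` only scales the law of
  -- that coordinate.
  have hmap : ((Measure.infinitePi μ).restrict B).map (fun x => x j) =
      (∏ i ∈ s.erase j, μ i (t i)) • μ j := by
    ext A hA
    rw [Measure.map_apply (measurable_pi_apply j) hA,
      Measure.restrict_apply (measurable_pi_apply j hA), Measure.smul_apply, smul_eq_mul]
    have : (fun x : ∀ i, X i => x j) ⁻¹' A ∩ B =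
        (↑(insert j (s.erase j)) : Set ι).pi (Function.update t j A) := by
      ext x
      simp only [Set.mem_inter_iff, Set.mem_preimage, hB, Set.mem_pi, Finset.coe_insert,
        Set.mem_insert_iff, forall_eq_or_imp, Function.update_self, Finset.mem_coe]
      refine and_congr Iff.rfl (forall₂_congr fun i hi => ?_)
      rw [Function.update_of_ne (Finset.ne_of_mem_erase hi)]
    rw [this, Measure.infinitePi_pi, Finset.prod_insert (Finset.notMem_erase j s),
      Function.update_self, mul_comm]
    · congr 1
      refine Finset.prod_congr rfl fun i hi => ?_
      rw [Function.update_of_ne (Finset.ne_of_mem_erase hi)]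
    · intro i _
      rcases eq_or_ne i j with rfl | hij
      · rwa [Function.update_self]
      · rw [Function.update_of_ne hij]; exact ht i
  have hright : ∏ i ∈ s, Function.update μ j ((μ j).withDensity ρ) i (t i) =
      (∏ i ∈ s.erase j, μ i (t i)) * (μ j).withDensity ρ T := by
    have he : ∏ i ∈ s.erase j, Function.update μ j ((μ j).withDensity ρ) i (t i) =
        ∏ i ∈ s.erase j, μ i (t i) := Finset.prod_congr rfl fun i hi => by
      rw [Function.update_of_ne (Finset.ne_of_mem_erase hi)]
    by_cases hj : j ∈ s
    · rw [← Finset.prod_erase_mul _ _ hj, he, Function.update_self, hT, if_pos hj]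
    · have h1 := measure_univ (μ := Function.update μ j ((μ j).withDensity ρ) j)
      rw [Function.update_self] at h1
      rw [hT, if_neg hj, h1, mul_one, ← he, Finset.erase_eq_of_notMem hj]
  have hpre : MeasurableSet ((fun x : ∀ i, X i => x j) ⁻¹' T) := measurable_pi_apply j hTm
  rw [hright, withDensity_apply _ (by rw [hbox]; exact hpre.inter hBm), hbox,
    ← Measure.restrict_restrict hpre, ← setLIntegral_map hTm hρ (measurable_pi_apply j), hmap,
    Measure.restrict_smul, lintegral_smul_measure, withDensity_apply _ hTm, smul_eq_mul]

/-- The vector with `j`-th coordinate `c` and all other coordinates zero. -/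
abbrev coordVec (j : ℕ) (c : ℂ) : Ell2 := lp.single 2 j c

theorem continuous_coord (j : ℕ) : Continuous fun x : Ell2 => x j :=
  (lp.lipschitzWith_one_eval (E := fun _ : ℕ => ℂ) 2 j).continuous

theorem coordVec_apply (j : ℕ) (c : ℂ) (i : ℕ) :
    coordVec j c i = Function.update (0 : ℕ → ℂ) j c i := by
  rcases eq_or_ne i j with rfl | h
  · simp [coordVec]
  · simp [coordVec, h]

theorem gaussianSeq_withDensity_map_add {a : ℕ → ℝ} (ha : ∀ i, 0 < a i) (j : ℕ) (c : ℂ) :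
    ((gaussianSeq a).withDensity fun x => ENNReal.ofReal (shiftDensity (a j) c (x j))).map
      (fun x i => x i + Function.update (0 : ℕ → ℂ) j c i) = gaussianSeq a := by
  set μ : ℕ → Measure ℂ := fun i => gaussianComplex (a i) with hμ
  set ρ : ℂ → ENNReal := fun w => ENNReal.ofReal (shiftDensity (a j) c w) with hρ
  have hρm : Measurable ρ := measurable_ofReal_shiftDensity _ _
  have hmap : ((μ j).withDensity ρ).map (· + c) = μ j :=
    gaussianComplex_withDensity_map_add (ha j) c
  -- Total mass is preserved by push-forward, so no exponential integral has to be computed.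
  have hprob : IsProbabilityMeasure ((μ j).withDensity ρ) := by
    refine ⟨?_⟩
    have h := Measure.map_apply (μ := (μ j).withDensity ρ) (measurable_add_const c)
      MeasurableSet.univ
    rw [hmap, Set.preimage_univ, measure_univ] at h
    exact h.symm
  have : ∀ i, IsProbabilityMeasure (Function.update μ j ((μ j).withDensity ρ) i) := by
    intro i
    rcases eq_or_ne i j with rfl | h
    · rwa [Function.update_self]
    · rw [Function.update_of_ne h]; infer_instance
  have h1 := infinitePi_update_withDensity μ j hρm
  have h2 := Measure.infinitePi_map_pi (Function.update μ j ((μ j).withDensity ρ))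
    (f := fun i w => w + Function.update (0 : ℕ → ℂ) j c i) fun i => measurable_add_const _
  rw [h1] at h2
  refine h2.trans ?_
  unfold gaussianSeq
  congr 1
  funext i
  rcases eq_or_ne i j with rfl | h
  · simpa only [Function.update_self] using hmap
  · simp only [Function.update_of_ne h, Pi.zero_apply, add_zero, Measure.map_id']; rfl

instance isFiniteMeasure_gaussianEll2 (a : ℕ → ℝ) : IsFiniteMeasure (gaussianEll2 a) := by
  refine ⟨?_⟩
  rw [gaussianEll2, measurableEmbedding_coe.comap_apply]
  exact measure_lt_top _ _

/-- Translating the Gaussian measure along a coordinate. -/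
theorem gaussianEll2_withDensity_map_add {a : ℕ → ℝ} (ha : ∀ i, 0 < a i) (j : ℕ) (c : ℂ) :
    ((gaussianEll2 a).withDensity fun x => ENNReal.ofReal (shiftDensity (a j) c (x j))).map
      (· + coordVec j c) = gaussianEll2 a := by
  have hadd : Measurable fun x : Ell2 => x + coordVec j c :=
    (continuous_add_const (coordVec j c)).measurable
  have hcm := measurableEmbedding_coe
  have hsm : Measurable fun (x : ℕ → ℂ) i => x i + Function.update (0 : ℕ → ℂ) j c i := by
    fun_prop
  ext A hA
  have hA' := hcm.measurableSet_image.2 hA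
  have hpre := hadd hA
  rw [Measure.map_apply hadd hA, withDensity_apply _ hpre, gaussianEll2, hcm.comap_apply]
  conv_rhs => rw [← gaussianSeq_withDensity_map_add ha j c, Measure.map_apply hsm hA',
    withDensity_apply _ (hsm hA')]
  -- The shift vector lies in ℓ², so translation in `ℂ^∞` maps ℓ² onto itself and the identity
  -- descends to ℓ².
  have hset : (fun (x : ℕ → ℂ) i => x i + Function.update (0 : ℕ → ℂ) j c i) ⁻¹'
      ((fun z : Ell2 => (z : ℕ → ℂ)) '' A) =
      (fun z : Ell2 => (z : ℕ → ℂ)) '' ((fun x : Ell2 => x + coordVec j c) ⁻¹' A) := by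
    ext x
    constructor
    · rintro ⟨z, hz, hzx⟩
      refine ⟨z - coordVec j c, by simpa using hz, ?_⟩
      funext i
      have h1 := congrFun hzx i
      simp only at h1
      simp only [lp.coeFn_sub, Pi.sub_apply, h1, coordVec_apply, add_sub_cancel_right]
    · rintro ⟨z, hz, rfl⟩
      refine ⟨z + coordVec j c, hz, ?_⟩
      funext i
      simp only [lp.coeFn_add, Pi.add_apply, coordVec_apply]
  rw [hset]
  set B := (fun x : Ell2 => x + coordVec j c) ⁻¹' A
  have hr : (gaussianSeq a).restrict ((fun z : Ell2 => (z : ℕ → ℂ)) '' B) =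
      (((gaussianSeq a).comap fun z : Ell2 => (z : ℕ → ℂ)).restrict B).map
        fun z : Ell2 => (z : ℕ → ℂ) := by
    conv_rhs => rw [← Set.preimage_image_eq B hcm.injective]
    rw [← hcm.restrict_map, hcm.map_comap,
      Measure.restrict_restrict_of_subset (Set.image_subset_range _ _)]
  rw [hr, hcm.lintegral_map]

/-- Change of variables under a translation along a coordinate. -/
theorem integral_gaussianEll2_translate {a : ℕ → ℝ} (ha : ∀ i, 0 < a i) (j : ℕ) (c : ℂ)
    (F : Ell2 → ℂ) :
    ∫ x, F x ∂(gaussianEll2 a) =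
      ∫ x, F (x + coordVec j c) * (shiftDensity (a j) c (x j) : ℂ) ∂(gaussianEll2 a) := by
  have hdm : Measurable fun x : Ell2 => Real.toNNReal (shiftDensity (a j) c (x j)) :=
    ((continuous_shiftDensity _ _).comp (continuous_coord j)).measurable.real_toNNReal
  -- Translation is a homeomorphism, hence a measurable embedding, so `F` may be arbitrary.
  have hemb : MeasurableEmbedding fun x : Ell2 => x + coordVec j c :=
    (Homeomorph.addRight (coordVec j c)).measurableEmbedding
  conv_lhs => rw [← gaussianEll2_withDensity_map_add ha j c, hemb.integral_map]
  refine (integral_withDensity_eq_integral_smul hdm _).trans ?_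
  refine integral_congr_ae (Eventually.of_forall fun x => ?_)
  change ((Real.toNNReal (shiftDensity (a j) c (x j)) : ℝ) • F (x + coordVec j c) : ℂ) = _
  rw [Real.coe_toNNReal _ (shiftDensity_nonneg _ _ _), Complex.real_smul, mul_comm]


/-! ### Partial derivatives as line derivatives -/

theorem slice_eq (u : ℂ) (j : ℕ) (f : Ell2 → ℂ) (z : Ell2) :
    slice u j f z = fun τ : ℝ => f (z + τ • coordVec j u) := by
  funext τ
  rw [slice, coordVec, ← lp.single_smul, Complex.real_smul]

theorem HasPartial.hasLineDerivAt {u : ℂ} {j : ℕ} {f : Ell2 → ℂ} {z : Ell2}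
    (h : HasPartial u j f z) :
    HasLineDerivAt ℝ f (partialDeriv u j f z) z (coordVec j u) := by
  have := h.hasDerivAt
  rw [HasLineDerivAt, ← slice_eq]
  exact this

theorem hasPartial_of_hasLineDerivAt {u : ℂ} {j : ℕ} {f : Ell2 → ℂ} {z : Ell2} {d : ℂ}
    (h : HasLineDerivAt ℝ f d z (coordVec j u)) : HasPartial u j f z := by
  rw [HasLineDerivAt, ← slice_eq] at h
  exact h.differentiableAt

theorem partialDeriv_of_hasLineDerivAt {u : ℂ} {j : ℕ} {f : Ell2 → ℂ} {z : Ell2} {d : ℂ}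
    (h : HasLineDerivAt ℝ f d z (coordVec j u)) : partialDeriv u j f z = d := by
  rw [HasLineDerivAt, ← slice_eq] at h
  exact h.deriv

theorem HasPartial.add_smul {u : ℂ} {j : ℕ} {f g : Ell2 → ℂ} {z : Ell2} (a b : ℂ)
    (hf : HasPartial u j f z) (hg : HasPartial u j g z) :
    HasLineDerivAt ℝ (a • f + b • g) (a * partialDeriv u j f z + b * partialDeriv u j g z) z
      (coordVec j u) :=
  (HasDerivAt.const_mul a hf.hasLineDerivAt).add (HasDerivAt.const_mul b hg.hasLineDerivAt)

theorem contDiffPartial_zero {f : Ell2 → ℂ} : ContDiffPartial Set.univ 0 f ↔ Continuous f := by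
  rw [ContDiffPartial, continuousOn_univ]

theorem contDiffPartial_succ {f : Ell2 → ℂ} {k : ℕ} :
    ContDiffPartial Set.univ (k + 1) f ↔ Continuous f ∧ ∀ u ∈ ({1, Complex.I} : Set ℂ), ∀ j : ℕ,
      (∀ z, HasPartial u j f z) ∧ ContDiffPartial Set.univ k (partialDeriv u j f) := by
  rw [ContDiffPartial, continuousOn_univ]
  simp only [Set.mem_univ, true_imp_iff]

theorem ContDiffPartial.add_smul {k : ℕ} {f g : Ell2 → ℂ} (a b : ℂ)
    (hf : ContDiffPartial Set.univ k f) (hg : ContDiffPartial Set.univ k g) :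
    ContDiffPartial Set.univ k (a • f + b • g) := by
  induction k generalizing f g with
  | zero =>
    rw [contDiffPartial_zero] at *
    exact (hf.const_smul a).add (hg.const_smul b)
  | succ k ih =>
    rw [contDiffPartial_succ] at *
    refine ⟨(hf.1.const_smul a).add (hg.1.const_smul b), fun u hu j => ?_⟩
    have h := fun z => ((hf.2 u hu j).1 z).add_smul a b ((hg.2 u hu j).1 z)
    refine ⟨fun z => hasPartial_of_hasLineDerivAt (h z), ?_⟩
    have e : partialDeriv u j (a • f + b • g) =
        a • partialDeriv u j f + b • partialDeriv u j g :=
      funext fun z => partialDeriv_of_hasLineDerivAt (h z)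
    rw [e]
    exact ih (hf.2 u hu j).2 (hg.2 u hu j).2

theorem SmoothPartial.continuous {f : Ell2 → ℂ} (hf : SmoothPartial Set.univ f) : Continuous f :=
  contDiffPartial_zero.1 (hf 0)

theorem SmoothPartial.hasPartial {f : Ell2 → ℂ} (hf : SmoothPartial Set.univ f) {u : ℂ}
    (hu : u ∈ ({1, Complex.I} : Set ℂ)) (j : ℕ) (z : Ell2) : HasPartial u j f z :=
  ((contDiffPartial_succ.1 (hf 1)).2 u hu j).1 z

theorem SmoothPartial.partialDeriv {f : Ell2 → ℂ} (hf : SmoothPartial Set.univ f) {u : ℂ}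
    (hu : u ∈ ({1, Complex.I} : Set ℂ)) (j : ℕ) :
    SmoothPartial Set.univ (partialDeriv u j f) := fun k =>
  ((contDiffPartial_succ.1 (hf (k + 1))).2 u hu j).2

theorem SmoothPartial.add_smul {f g : Ell2 → ℂ} (a b : ℂ) (hf : SmoothPartial Set.univ f)
    (hg : SmoothPartial Set.univ g) : SmoothPartial Set.univ (a • f + b • g) :=
  fun k => (hf k).add_smul a b (hg k)

theorem contDiffPartial_zero_fun (k : ℕ) : ContDiffPartial Set.univ k (0 : Ell2 → ℂ) := by
  induction k with
  | zero => exact contDiffPartial_zero.2 continuous_zero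
  | succ k ih =>
    refine contDiffPartial_succ.2 ⟨continuous_zero, fun u _ j => ?_⟩
    have h : ∀ z, HasLineDerivAt ℝ (0 : Ell2 → ℂ) 0 z (coordVec j u) :=
      fun _ => hasDerivAt_const _ _
    refine ⟨fun z => hasPartial_of_hasLineDerivAt (h z), ?_⟩
    have e : EllTwo.partialDeriv u j (0 : Ell2 → ℂ) = 0 :=
      funext fun z => partialDeriv_of_hasLineDerivAt (h z)
    rwa [e]

theorem SmoothPartial.partialDeriv_comm {f : Ell2 → ℂ} (hf : SmoothPartial Set.univ f) {u v : ℂ}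
    (hu : u ∈ ({1, Complex.I} : Set ℂ)) (hv : v ∈ ({1, Complex.I} : Set ℂ)) (j k : ℕ) :
    EllTwo.partialDeriv u j (EllTwo.partialDeriv v k f) =
      EllTwo.partialDeriv v k (EllTwo.partialDeriv u j f) := by
  funext z
  have hfu := hf.partialDeriv hu j
  have hfv := hf.partialDeriv hv k
  exact lineDeriv_comm (fun z => (hf.hasPartial hv k z).hasLineDerivAt)
    (fun z => (hf.hasPartial hu j z).hasLineDerivAt)
    (fun z => (hfv.hasPartial hv k z).hasLineDerivAt)
    (fun z => (hfv.hasPartial hu j z).hasLineDerivAt)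
    (fun z => (hfu.hasPartial hv k z).hasLineDerivAt)
    (fun z => (hfu.hasPartial hu j z).hasLineDerivAt)
    hfv.continuous hfu.continuous (hfv.partialDeriv hv k).continuous
    (hfv.partialDeriv hu j).continuous (hfu.partialDeriv hv k).continuous
    (hfu.partialDeriv hu j).continuous z

/-! ### The commuting operators `∂_j` and `∂̄_j` on smooth functions -/

/-- `C^∞(ℓ²)` as a complex vector space. -/
def smoothSubmodule : Submodule ℂ (Ell2 → ℂ) where
  carrier := {f | SmoothPartial Set.univ f}
  zero_mem' := contDiffPartial_zero_fun
  add_mem' {f g} hf hg := by simpa using SmoothPartial.add_smul 1 1 hf hg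
  smul_mem' c f hf := by simpa using SmoothPartial.add_smul c 0 hf hf

/-- The operator `partialDeriv u j` on smooth functions. -/
def partialEnd (u : ℂ) (hu : u ∈ ({1, Complex.I} : Set ℂ)) (j : ℕ) :
    Module.End ℂ smoothSubmodule where
  toFun f := ⟨partialDeriv u j f, SmoothPartial.partialDeriv f.2 hu j⟩
  map_add' f g := by
    ext z
    have h := partialDeriv_of_hasLineDerivAt
      ((SmoothPartial.hasPartial f.2 hu j z).add_smul 1 1 (SmoothPartial.hasPartial g.2 hu j z))
    simpa using h
  map_smul' c f := by
    ext z
    have h := partialDeriv_of_hasLineDerivAt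
      ((SmoothPartial.hasPartial f.2 hu j z).add_smul c 0 (SmoothPartial.hasPartial f.2 hu j z))
    simpa using h

theorem commute_partialEnd {u v : ℂ} (hu : u ∈ ({1, Complex.I} : Set ℂ))
    (hv : v ∈ ({1, Complex.I} : Set ℂ)) (j k : ℕ) :
    Commute (partialEnd u hu j) (partialEnd v hv k) :=
  LinearMap.ext fun f => Subtype.ext (SmoothPartial.partialDeriv_comm f.2 hu hv j k)

theorem one_mem_directions : (1 : ℂ) ∈ ({1, Complex.I} : Set ℂ) := Or.inl rfl

theorem I_mem_directions : Complex.I ∈ ({1, Complex.I} : Set ℂ) := Or.inr rfl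

/-- The operator `∂_j` on smooth functions. -/
def delEnd (j : ℕ) : Module.End ℂ smoothSubmodule :=
  (1 / 2 : ℂ) • (partialEnd 1 one_mem_directions j -
    Complex.I • partialEnd Complex.I I_mem_directions j)

/-- The operator `∂̄_j` on smooth functions. -/
def delBarEnd (j : ℕ) : Module.End ℂ smoothSubmodule :=
  (1 / 2 : ℂ) • (partialEnd 1 one_mem_directions j +
    Complex.I • partialEnd Complex.I I_mem_directions j)

theorem coe_delEnd (j : ℕ) (f : smoothSubmodule) : (delEnd j f : Ell2 → ℂ) = del j f := rfl

theorem coe_delBarEnd (j : ℕ) (f : smoothSubmodule) :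
    (delBarEnd j f : Ell2 → ℂ) = delBar j f := rfl

theorem commute_smul_add_smul {A : Type*} [Ring A] [Algebra ℂ A] {x y x' y' : A} (a b c : ℂ)
    (h1 : Commute x x') (h2 : Commute x y') (h3 : Commute y x') (h4 : Commute y y') :
    Commute (c • (x + a • y)) (c • (x' + b • y')) :=
  (((h1.add_right (h2.smul_right b)).add_left
    ((h3.smul_left a).add_right ((h4.smul_left a).smul_right b))).smul_left c).smul_right c

/-- The form `c • (x + a • y)` required by `commute_smul_add_smul`. -/
theorem delEnd_eq (j : ℕ) : delEnd j = (1 / 2 : ℂ) • (partialEnd 1 one_mem_directions j +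
    (-Complex.I) • partialEnd Complex.I I_mem_directions j) := by
  ext1 f
  simp only [delEnd, LinearMap.smul_apply, LinearMap.sub_apply, LinearMap.add_apply]
  module

theorem commute_delEnd_delEnd (j k : ℕ) : Commute (delEnd j) (delEnd k) := by
  rw [delEnd_eq, delEnd_eq]
  exact commute_smul_add_smul (A := Module.End ℂ smoothSubmodule) _ _ _ (commute_partialEnd _ _ j k) (commute_partialEnd _ _ j k)
    (commute_partialEnd _ _ j k) (commute_partialEnd _ _ j k)

theorem commute_delEnd_delBarEnd (j k : ℕ) : Commute (delEnd j) (delBarEnd k) := by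
  rw [delEnd_eq]
  exact commute_smul_add_smul (A := Module.End ℂ smoothSubmodule) _ _ _ (commute_partialEnd _ _ j k) (commute_partialEnd _ _ j k)
    (commute_partialEnd _ _ j k) (commute_partialEnd _ _ j k)

theorem commute_delBarEnd_delBarEnd (j k : ℕ) : Commute (delBarEnd j) (delBarEnd k) := by
  simp only [delBarEnd]
  exact commute_smul_add_smul (A := Module.End ℂ smoothSubmodule) _ _ _ (commute_partialEnd _ _ j k) (commute_partialEnd _ _ j k)
    (commute_partialEnd _ _ j k) (commute_partialEnd _ _ j k)

/-- The product `D 0 ^ α 0 * ⋯ * D (n - 1) ^ α (n - 1)`, where `α j = 0` for `n ≤ j`. -/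
def multiPow {M : Type*} [Monoid M] (D : ℕ → M) (α : ℕ →₀ ℕ) : M :=
  ((List.range (α.support.sup Nat.succ)).map fun j => D j ^ α j).prod

/-- Surplus factors have exponent zero; two multi-indices can thus be compared over one common
range. -/
theorem multiPow_eq_of_le {M : Type*} [Monoid M] (D : ℕ → M) (α : ℕ →₀ ℕ) {N : ℕ}
    (hN : α.support.sup Nat.succ ≤ N) :
    multiPow D α = ((List.range N).map fun j => D j ^ α j).prod := by
  induction N, hN using Nat.le_induction with
  | base => rfl
  | succ N hN ih =>
    have h0 : α N = 0 := by
      by_contra h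
      have := Finset.le_sup (f := Nat.succ) (Finsupp.mem_support_iff.2 h)
      omega
    rw [List.range_succ, List.map_append, List.prod_append, ← ih]
    simp [h0]

/-- Commutativity moves the extra factor from position `j` to the far right, where it acts on the
function before all others. -/
theorem multiPow_add_single {M : Type*} [Monoid M] {D : ℕ → M} (hD : ∀ i j, Commute (D i) (D j))
    (α : ℕ →₀ ℕ) (j : ℕ) : multiPow D (α + Finsupp.single j 1) = multiPow D α * D j := by
  have key : ∀ N, ((List.range N).map fun i => D i ^ (α + Finsupp.single j 1 : ℕ →₀ ℕ) i).prod =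
      ((List.range N).map fun i => D i ^ α i).prod * (if j < N then D j else 1) := by
    intro N
    induction N with
    | zero => simp
    | succ N ih =>
      simp only [List.range_succ, List.map_append, List.prod_append, ih, List.map_cons,
        List.map_nil, List.prod_cons, List.prod_nil, mul_one]
      rcases lt_trichotomy j N with h | h | h
      · have : (α + Finsupp.single j 1 : ℕ →₀ ℕ) N = α N := by simp [h.ne]
        rw [if_pos h, if_pos (by omega), this, mul_assoc, mul_assoc, ((hD j N).pow_right _).eq]
      · subst h
        simp [pow_succ, mul_assoc]
      · have : (α + Finsupp.single j 1 : ℕ →₀ ℕ) N = α N := by simp [h.ne']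
        rw [if_neg (by omega), if_neg (by omega), this, mul_one, mul_one]
  set N := max (j + 1) (max (α.support.sup Nat.succ)
    ((α + Finsupp.single j 1).support.sup Nat.succ)) with hN
  have hj : j < N := lt_of_lt_of_le (Nat.lt_succ_self j) (le_max_left _ _)
  rw [multiPow_eq_of_le D _ (N := N) ((le_max_right _ _).trans (le_max_right _ _)), key,
    if_pos hj, ← multiPow_eq_of_le D α ((le_max_left _ _).trans (le_max_right _ _))]

theorem coe_multiPow {D : ℕ → (Ell2 → ℂ) → Ell2 → ℂ} {T : ℕ → Module.End ℂ smoothSubmodule}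
    (hDT : ∀ j f, (T j f : Ell2 → ℂ) = D j f) (α : ℕ →₀ ℕ) (f : smoothSubmodule) :
    (multiPow T α f : Ell2 → ℂ) = multiOp D α f := by
  unfold multiPow multiOp
  induction List.range (α.support.sup Nat.succ) with
  | nil => rfl
  | cons j l ih =>
    rw [List.map_cons, List.prod_cons, List.foldr_cons, ← ih, Module.End.mul_apply]
    generalize (l.map fun j => T j ^ α j).prod f = g
    induction α j with
    | zero => rfl
    | succ n ihn => rw [Function.iterate_succ_apply', ← ihn, pow_succ', Module.End.mul_apply, hDT]

theorem multiPow_commute {M : Type*} [Monoid M] {D : ℕ → M} {x : M} (h : ∀ j, Commute x (D j))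
    (α : ℕ →₀ ℕ) : Commute x (multiPow D α) := by
  refine Commute.list_prod_right _ _ fun y hy => ?_
  obtain ⟨j, -, rfl⟩ := List.mem_map.1 hy
  exact (h j).pow_right _

theorem coe_delDelBar (α β : ℕ →₀ ℕ) (f : smoothSubmodule) :
    ((multiPow delEnd α * multiPow delBarEnd β) f : Ell2 → ℂ) = delDelBar α β f := by
  rw [Module.End.mul_apply, coe_multiPow coe_delEnd, coe_multiPow coe_delBarEnd]
  rfl

/-- Smooth functions all of whose derivatives `∂_α ∂̄_β f` are bounded. -/
def SmoothBounded (f : smoothSubmodule) : Prop :=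
  ∀ α β : ℕ →₀ ℕ, ∃ C : ℝ, ∀ z, ‖((multiPow delEnd α * multiPow delBarEnd β) f : Ell2 → ℂ) z‖ ≤ C

theorem SmoothBounded.add_smul {f g : smoothSubmodule} (a b : ℂ) (hf : SmoothBounded f)
    (hg : SmoothBounded g) : SmoothBounded (a • f + b • g) := by
  intro α β
  obtain ⟨C, hC⟩ := hf α β
  obtain ⟨D, hD⟩ := hg α β
  refine ⟨‖a‖ * C + ‖b‖ * D, fun z => ?_⟩
  rw [map_add, map_smul, map_smul]
  refine (norm_add_le _ _).trans (add_le_add ?_ ?_)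
  · exact (norm_mul_le _ _).trans (mul_le_mul_of_nonneg_left (hC z) (norm_nonneg _))
  · exact (norm_mul_le _ _).trans (mul_le_mul_of_nonneg_left (hD z) (norm_nonneg _))

theorem SmoothBounded.delEnd {f : smoothSubmodule} (hf : SmoothBounded f) (j : ℕ) :
    SmoothBounded (delEnd j f) := by
  intro α β
  obtain ⟨C, hC⟩ := hf (α + Finsupp.single j 1) β
  refine ⟨C, fun z => ?_⟩
  rw [multiPow_add_single commute_delEnd_delEnd, mul_assoc,
    (multiPow_commute (fun k => commute_delEnd_delBarEnd j k) β).eq, ← mul_assoc] at hC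
  exact hC z

theorem SmoothBounded.delBarEnd {f : smoothSubmodule} (hf : SmoothBounded f) (j : ℕ) :
    SmoothBounded (delBarEnd j f) := by
  intro α β
  obtain ⟨C, hC⟩ := hf α (β + Finsupp.single j 1)
  refine ⟨C, fun z => ?_⟩
  rw [multiPow_add_single commute_delBarEnd_delBarEnd, ← mul_assoc] at hC
  exact hC z

/-- Inverting the Wirtinger formulas: `∂/∂x = ∂ + ∂̄` and `∂/∂y = √-1 (∂ - ∂̄)`. -/
theorem SmoothBounded.partialEnd {f : smoothSubmodule} (hf : SmoothBounded f) {u : ℂ}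
    (hu : u ∈ ({1, Complex.I} : Set ℂ)) (j : ℕ) : SmoothBounded (partialEnd u hu j f) := by
  rcases hu with rfl | rfl
  · convert SmoothBounded.add_smul 1 1 (hf.delEnd j) (hf.delBarEnd j) using 1
    simp only [EllTwo.delEnd, EllTwo.delBarEnd, LinearMap.smul_apply, LinearMap.sub_apply,
      LinearMap.add_apply]
    module
  · convert SmoothBounded.add_smul Complex.I (-Complex.I) (hf.delEnd j) (hf.delBarEnd j) using 1
    simp only [EllTwo.delEnd, EllTwo.delBarEnd, LinearMap.smul_apply, LinearMap.sub_apply,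
      LinearMap.add_apply]
    match_scalars
    · linear_combination Complex.I_sq
    · ring


theorem SmoothBounded.bounded {f : smoothSubmodule} (hf : SmoothBounded f) :
    ∃ C : ℝ, ∀ z, ‖(f : Ell2 → ℂ) z‖ ≤ C := by
  simpa [multiPow] using hf 0 0

/-! ### Test functions -/

/-- Continuous bounded functions vanishing outside the ball of radius `R`. -/
def BoundedSupported (R : ℝ) (θ : Ell2 → ℂ) : Prop :=
  Continuous θ ∧ (∃ C : ℝ, ∀ z, ‖θ z‖ ≤ C) ∧ ∀ z, R < ‖z‖ → θ z = 0

/-- Functions of class `C^k` vanishing outside the ball of radius `R`, with bounded partial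
derivatives. -/
def TestFn (R : ℝ) : ℕ → (Ell2 → ℂ) → Prop
  | 0, θ => BoundedSupported R θ
  | k + 1, θ => BoundedSupported R θ ∧
      ∀ u ∈ ({1, Complex.I} : Set ℂ), ∀ j : ℕ,
        (∀ z, HasPartial u j θ z) ∧ TestFn R k (partialDeriv u j θ)

theorem testFn_succ {R : ℝ} {k : ℕ} {θ : Ell2 → ℂ} : TestFn R (k + 1) θ ↔
    BoundedSupported R θ ∧ ∀ u ∈ ({1, Complex.I} : Set ℂ), ∀ j : ℕ,
      (∀ z, HasPartial u j θ z) ∧ TestFn R k (partialDeriv u j θ) := Iff.rfl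

theorem TestFn.boundedSupported {R : ℝ} {k : ℕ} {θ : Ell2 → ℂ} (h : TestFn R k θ) :
    BoundedSupported R θ := by
  cases k with
  | zero => exact h
  | succ k => exact h.1

theorem partialDeriv_eq_zero {R : ℝ} {θ : Ell2 → ℂ} (h : ∀ z, R < ‖z‖ → θ z = 0) (u : ℂ) (j : ℕ)
    (z : Ell2) (hz : R < ‖z‖) : partialDeriv u j θ z = 0 := by
  have h0 : HasLineDerivAt ℝ (0 : Ell2 → ℂ) 0 z (coordVec j u) := hasDerivAt_const _ _
  refine partialDeriv_of_hasLineDerivAt (h0.congr_of_eventuallyEq ?_)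
  filter_upwards [(isOpen_lt continuous_const continuous_norm).mem_nhds hz] with w hw
  exact h w hw

theorem SmoothBounded.testFn {f : smoothSubmodule} (hf : SmoothBounded f) {R : ℝ}
    (hR : ∀ z, R < ‖z‖ → (f : Ell2 → ℂ) z = 0) (k : ℕ) : TestFn R k f := by
  have h0 : ∀ {f}, SmoothBounded f → (∀ z, R < ‖z‖ → (f : Ell2 → ℂ) z = 0) → BoundedSupported R f :=
    fun {f} hf hR => ⟨SmoothPartial.continuous f.2, hf.bounded, hR⟩
  induction k generalizing f with
  | zero => exact h0 hf hR
  | succ k ih =>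
    exact testFn_succ.2 ⟨h0 hf hR, fun u hu j => ⟨SmoothPartial.hasPartial f.2 hu j,
      ih (hf.partialEnd hu j) (partialDeriv_eq_zero hR u j)⟩⟩

theorem uniformlyIncluded_univ {S : Set Ell2} :
    UniformlyIncluded S Set.univ ↔ Bornology.IsBounded S := by
  simp [UniformlyIncluded, distBoundary]

/-- The radius must not depend on `k`: differentiation does not enlarge the support, so a ball
containing the support of `θ` serves all orders. -/
theorem CInftyZero.exists_testFn {θ : Ell2 → ℂ} (h : CInftyZero Set.univ θ) :
    ∃ R : ℝ, ∀ k, TestFn R k θ := by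
  obtain ⟨hs, hb, hd⟩ := h
  obtain ⟨R, hR⟩ := (uniformlyIncluded_univ.1 hb).subset_closedBall 0
  refine ⟨R, fun k => SmoothBounded.testFn (f := ⟨θ, hs⟩) (fun α β => ?_) (fun z hz => ?_) k⟩
  · obtain ⟨C, hC⟩ := hd α β
    exact ⟨C, fun z => by rw [coe_delDelBar]; exact hC z trivial⟩
  · by_contra h0
    have := hR (subset_closure ⟨trivial, h0⟩)
    rw [mem_closedBall_zero_iff] at this
    linarith


instance instSecondCountableTopologyEll2 : SecondCountableTopology Ell2 :=
  have := separableSpace_ell2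
  UniformSpace.secondCountable_of_separable _

theorem norm_coordVec (j : ℕ) (c : ℂ) : ‖coordVec j c‖ = ‖c‖ :=
  lp.norm_single (E := fun _ : ℕ => ℂ) (p := 2) (by norm_num) j c

theorem smul_coordVec (t : ℝ) (j : ℕ) (c : ℂ) : t • coordVec j c = coordVec j (t * c) := by
  rw [coordVec, ← lp.single_smul, Complex.real_smul]

/-! ### Operations on test functions -/

theorem BoundedSupported.add_smul {R : ℝ} {θ η : Ell2 → ℂ} (a b : ℂ)
    (hθ : BoundedSupported R θ) (hη : BoundedSupported R η) :
    BoundedSupported R (a • θ + b • η) := by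
  obtain ⟨h1, ⟨C, hC⟩, h2⟩ := hθ
  obtain ⟨k1, ⟨D, hD⟩, k2⟩ := hη
  refine ⟨(h1.const_smul a).add (k1.const_smul b), ⟨‖a‖ * C + ‖b‖ * D, fun z => ?_⟩,
    fun z hz => by simp [h2 z hz, k2 z hz]⟩
  refine (norm_add_le _ _).trans (add_le_add ?_ ?_)
  · exact (norm_mul_le _ _).trans (mul_le_mul_of_nonneg_left (hC z) (norm_nonneg _))
  · exact (norm_mul_le _ _).trans (mul_le_mul_of_nonneg_left (hD z) (norm_nonneg _))

theorem TestFn.add_smul {R : ℝ} {k : ℕ} {θ η : Ell2 → ℂ} (a b : ℂ) (hθ : TestFn R k θ)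
    (hη : TestFn R k η) : TestFn R k (a • θ + b • η) := by
  induction k generalizing θ η with
  | zero => exact BoundedSupported.add_smul a b hθ hη
  | succ k ih =>
    rw [testFn_succ] at *
    refine ⟨hθ.1.add_smul a b hη.1, fun u hu j => ?_⟩
    have h := fun z => ((hθ.2 u hu j).1 z).add_smul a b ((hη.2 u hu j).1 z)
    refine ⟨fun z => hasPartial_of_hasLineDerivAt (h z), ?_⟩
    have e : partialDeriv u j (a • θ + b • η) =
        a • partialDeriv u j θ + b • partialDeriv u j η :=
      funext fun z => partialDeriv_of_hasLineDerivAt (h z)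
    rw [e]
    exact ih (hθ.2 u hu j).2 (hη.2 u hu j).2

theorem TestFn.of_succ {R : ℝ} {k : ℕ} {θ : Ell2 → ℂ} (h : TestFn R (k + 1) θ) :
    TestFn R k θ := by
  induction k generalizing θ with
  | zero => exact h.boundedSupported
  | succ k ih => exact ⟨h.1, fun u hu j => ⟨(h.2 u hu j).1, ih (h.2 u hu j).2⟩⟩

/-- The real coordinate of `z_j` in the direction `u`. -/
def coordRe (u : ℂ) (j : ℕ) (z : Ell2) : ℝ := (z j).re * u.re + (z j).im * u.im

theorem coordRe_add (u : ℂ) (j : ℕ) (z w : Ell2) :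
    coordRe u j (z + w) = coordRe u j z + coordRe u j w := by
  simp only [coordRe, lp.coeFn_add, Pi.add_apply, Complex.add_re, Complex.add_im]
  ring

theorem coordRe_smul (u : ℂ) (j : ℕ) (t : ℝ) (z : Ell2) :
    coordRe u j (t • z) = t * coordRe u j z := by
  simp only [coordRe, lp.coeFn_smul, Pi.smul_apply, Complex.real_smul, Complex.re_ofReal_mul,
    Complex.im_ofReal_mul]
  ring

theorem abs_coordRe_le (u : ℂ) (j : ℕ) (z : Ell2) : |coordRe u j z| ≤ ‖z‖ * ‖u‖ := by
  have e : coordRe u j z = (z j * (starRingEnd ℂ) u).re := by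
    simp [coordRe, Complex.mul_re]
  rw [e]
  refine (Complex.abs_re_le_norm _).trans ?_
  rw [norm_mul, RCLike.norm_conj]
  exact mul_le_mul_of_nonneg_right (lp.norm_apply_le_norm two_ne_zero z j) (norm_nonneg _)

theorem continuous_coordRe (u : ℂ) (j : ℕ) : Continuous (coordRe u j) :=
  ((Complex.continuous_re.comp (continuous_coord j)).mul continuous_const).add
    ((Complex.continuous_im.comp (continuous_coord j)).mul continuous_const)

theorem coordRe_coordVec_self (u : ℂ) (j : ℕ) :
    coordRe u j (coordVec j u) = u.re ^ 2 + u.im ^ 2 := by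
  rw [coordRe, coordVec_apply, Function.update_self]
  ring

theorem hasLineDerivAt_coordRe (u : ℂ) (j : ℕ) (z v : Ell2) :
    HasLineDerivAt ℝ (fun w => (coordRe u j w : ℂ)) (coordRe u j v : ℂ) z v := by
  have h : HasDerivAt (fun t : ℝ => coordRe u j z + t * coordRe u j v) (coordRe u j v) 0 := by
    simpa using ((hasDerivAt_id (0 : ℝ)).mul_const (coordRe u j v)).const_add (coordRe u j z)
  simpa only [HasLineDerivAt, coordRe_add, coordRe_smul] using h.ofReal_comp

theorem BoundedSupported.coordRe_mul {R : ℝ} {θ : Ell2 → ℂ} (hθ : BoundedSupported R θ) (u : ℂ)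
    (j : ℕ) : BoundedSupported R (fun z => coordRe u j z * θ z) := by
  obtain ⟨h1, ⟨C, hC⟩, h2⟩ := hθ
  refine ⟨(Complex.continuous_ofReal.comp (continuous_coordRe u j)).mul h1,
    ⟨|R| * ‖u‖ * C, fun z => ?_⟩, fun z hz => by simp [h2 z hz]⟩
  have hC0 : 0 ≤ C := (norm_nonneg _).trans (hC 0)
  by_cases hz : R < ‖z‖
  · simp only [h2 z hz, mul_zero, norm_zero]; positivity
  · rw [norm_mul, Complex.norm_real, Real.norm_eq_abs]
    refine mul_le_mul ((abs_coordRe_le u j z).trans ?_) (hC z) (norm_nonneg _) (by positivity)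
    exact mul_le_mul_of_nonneg_right ((not_lt.1 hz).trans (le_abs_self R)) (norm_nonneg _)

/-- By Leibniz, with the derivative of a coordinate constant, each derivative is a combination of
`θ` and a coordinate times a derivative of `θ`, both of order `k`. -/
theorem TestFn.coordRe_mul {R : ℝ} {k : ℕ} {θ : Ell2 → ℂ} (hθ : TestFn R k θ) (u : ℂ) (j : ℕ) :
    TestFn R k (fun z => coordRe u j z * θ z) := by
  induction k generalizing θ with
  | zero => exact BoundedSupported.coordRe_mul hθ u j
  | succ k ih =>
    have hk := hθ.of_succ
    rw [testFn_succ] at *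
    refine ⟨hθ.1.coordRe_mul u j, fun v hv i => ?_⟩
    have h : ∀ z, HasLineDerivAt ℝ (fun z => (coordRe u j z : ℂ) * θ z)
        ((coordRe u j (coordVec i v) : ℂ) * θ z + coordRe u j z * partialDeriv v i θ z) z
        (coordVec i v) := fun z => by
      have := (hasLineDerivAt_coordRe u j z (coordVec i v)).fun_mul
        ((hθ.2 v hv i).1 z).hasLineDerivAt
      simpa only [HasLineDerivAt, zero_smul, add_zero] using this
    refine ⟨fun z => hasPartial_of_hasLineDerivAt (h z), ?_⟩
    have e : partialDeriv v i (fun z => (coordRe u j z : ℂ) * θ z) =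
        (coordRe u j (coordVec i v) : ℂ) • θ +
          (1 : ℂ) • fun z => coordRe u j z * partialDeriv v i θ z :=
      funext fun z => by rw [partialDeriv_of_hasLineDerivAt (h z)]; simp
    rw [e]
    exact hk.add_smul _ _ (ih (hθ.2 v hv i).2)

/-- The formal adjoint (up to sign) of the partial derivative with respect to the Gaussian
measure. -/
def gaussianAdjoint (a : ℕ → ℝ) (u : ℂ) (j : ℕ) (θ : Ell2 → ℂ) : Ell2 → ℂ :=
  (1 : ℂ) • partialDeriv u j θ + (-(1 / (a j : ℂ) ^ 2)) • fun z => coordRe u j z * θ z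

theorem TestFn.gaussianAdjoint {R : ℝ} {k : ℕ} {θ : Ell2 → ℂ} (hθ : TestFn R (k + 1) θ)
    (a : ℕ → ℝ) {u : ℂ} (hu : u ∈ ({1, Complex.I} : Set ℂ)) (j : ℕ) :
    TestFn R k (gaussianAdjoint a u j θ) :=
  TestFn.add_smul _ _ (hθ.2 u hu j).2 (hθ.of_succ.coordRe_mul u j)

/-! ### Functions that are Lipschitz on bounded sets -/

theorem lipOn_univ_iff {f : Ell2 → ℂ} : LipOn Set.univ f ↔
    ∀ r : ℝ, ∃ C : NNReal, LipschitzOnWith C f (Metric.closedBall 0 r) := by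
  constructor
  · intro h r
    obtain ⟨C, hC0, hC⟩ := h _ (uniformlyIncluded_univ.2 (Metric.isBounded_closedBall (x := 0)
      (r := r)))
    refine ⟨⟨C, hC0.le⟩, LipschitzOnWith.of_dist_le_mul fun z hz w hw => ?_⟩
    rw [dist_eq_norm, dist_eq_norm]
    exact hC z hz w hw
  · intro h S hS
    obtain ⟨r, hr⟩ := (uniformlyIncluded_univ.1 hS).subset_closedBall 0
    obtain ⟨C, hC⟩ := h r
    refine ⟨C + 1, by positivity, fun z hz w hw => ?_⟩
    have := hC.dist_le_mul z (hr hz) w (hr hw)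
    rw [dist_eq_norm, dist_eq_norm] at this
    exact this.trans (mul_le_mul_of_nonneg_right (by linarith) (norm_nonneg _))

theorem closedBall_mem_nhds_of_norm_lt {z : Ell2} {r : ℝ} (h : ‖z‖ < r) :
    Metric.closedBall (0 : Ell2) r ∈ 𝓝 z :=
  mem_of_superset (Metric.isOpen_ball.mem_nhds (mem_ball_zero_iff.2 h)) Metric.ball_subset_closedBall

theorem LipOn.continuous {f : Ell2 → ℂ} (hf : LipOn Set.univ f) : Continuous f := by
  rw [continuous_iff_continuousAt]
  intro z
  obtain ⟨C, hC⟩ := lipOn_univ_iff.1 hf (‖z‖ + 1)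
  exact hC.continuousOn.continuousAt (closedBall_mem_nhds_of_norm_lt (lt_add_one _))

theorem LipOn.bounded {f : Ell2 → ℂ} (hf : LipOn Set.univ f) (r : ℝ) :
    ∃ M : ℝ, 0 ≤ M ∧ ∀ z, ‖z‖ ≤ r → ‖f z‖ ≤ M := by
  -- The absolute value ensures that `0`, the point of comparison, lies in the ball even for
  -- negative `r`.
  obtain ⟨C, hC⟩ := lipOn_univ_iff.1 hf |r|
  refine ⟨‖f 0‖ + C * |r|, by positivity, fun z hz => ?_⟩
  have hzr : ‖z‖ ≤ |r| := hz.trans (le_abs_self r)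
  have := hC.dist_le_mul z (mem_closedBall_zero_iff.2 hzr) 0 (by simp)
  rw [dist_eq_norm, dist_zero_right] at this
  have h1 := norm_le_norm_add_norm_sub' (f z) (f 0)
  have h2 : (C : ℝ) * ‖z‖ ≤ C * |r| := mul_le_mul_of_nonneg_left hzr C.2
  linarith

theorem norm_sub_smul_le {z ζ : Ell2} {ε r s : ℝ} (hε : 0 ≤ ε) (hz : ‖z‖ ≤ r) (hζ : ‖ζ‖ ≤ s) :
    ‖z - (ε : ℂ) • ζ‖ ≤ r + ε * s := by
  refine (norm_sub_le _ _).trans (add_le_add hz ?_)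
  rw [norm_smul, Complex.norm_real, Real.norm_of_nonneg hε]
  exact mul_le_mul_of_nonneg_left hζ hε

theorem LipOn.exists_bound_mul {f : Ell2 → ℂ} (hf : LipOn Set.univ f) {R : ℝ} {θ : Ell2 → ℂ}
    (hθ : BoundedSupported R θ) {ε : ℝ} (hε : 0 ≤ ε) (r : ℝ) :
    ∃ M : ℝ, ∀ z, ‖z‖ ≤ r → ∀ ζ, ‖f (z - (ε : ℂ) • ζ) * θ ζ‖ ≤ M := by
  obtain ⟨-, ⟨C, hC⟩, h2⟩ := hθ
  obtain ⟨M, hM0, hM⟩ := hf.bounded (r + ε * R)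
  have hC0 : 0 ≤ C := (norm_nonneg _).trans (hC 0)
  refine ⟨M * C, fun z hz ζ => ?_⟩
  by_cases hζ : R < ‖ζ‖
  · rw [h2 ζ hζ, mul_zero, norm_zero]; positivity
  · rw [norm_mul]
    exact mul_le_mul (hM _ (norm_sub_smul_le hε hz (not_lt.1 hζ))) (hC ζ) (norm_nonneg _) hM0

theorem LipOn.continuous_integrand {f : Ell2 → ℂ} (hf : LipOn Set.univ f) {θ : Ell2 → ℂ}
    (hθ : Continuous θ) (ε : ℝ) (z : Ell2) : Continuous fun ζ => f (z - (ε : ℂ) • ζ) * θ ζ :=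
  (hf.continuous.comp (continuous_const.sub (continuous_id.const_smul (ε : ℂ)))).mul hθ

theorem LipOn.integrable_mollify {f : Ell2 → ℂ} (hf : LipOn Set.univ f) {R : ℝ} {θ : Ell2 → ℂ}
    (hθ : BoundedSupported R θ) {ε : ℝ} (hε : 0 ≤ ε) (a : ℕ → ℝ) (z : Ell2) :
    Integrable (fun ζ => f (z - (ε : ℂ) • ζ) * θ ζ) (gaussianEll2 a) := by
  obtain ⟨M, hM⟩ := hf.exists_bound_mul hθ hε ‖z‖
  exact (integrable_const M).mono' (hf.continuous_integrand hθ.1 ε z).aestronglyMeasurable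
    (Eventually.of_forall (hM z le_rfl))

/-! ### Derivatives of mollifications -/

theorem LipOn.mollify_add_smul {f : Ell2 → ℂ} (hf : LipOn Set.univ f) {R : ℝ} {θ η : Ell2 → ℂ}
    (hθ : BoundedSupported R θ) (hη : BoundedSupported R η) {ε : ℝ} (hε : 0 ≤ ε) (a : ℕ → ℝ)
    (b c : ℂ) :
    mollify a (b • θ + c • η) f ε = b • mollify a θ f ε + c • mollify a η f ε := by
  funext z
  simp only [mollify, Pi.add_apply, Pi.smul_apply, smul_eq_mul]
  rw [← integral_const_mul, ← integral_const_mul,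
    ← integral_add ((hf.integrable_mollify hθ hε a z).const_mul b)
      ((hf.integrable_mollify hη hε a z).const_mul c)]
  exact integral_congr_ae (Eventually.of_forall fun ζ => by ring)

theorem LipOn.mollify {f : Ell2 → ℂ} (hf : LipOn Set.univ f) {R : ℝ} {θ : Ell2 → ℂ}
    (hθ : BoundedSupported R θ) {ε : ℝ} (hε : 0 ≤ ε) (a : ℕ → ℝ) :
    LipOn Set.univ (mollify a θ f ε) := by
  rw [lipOn_univ_iff]
  intro r
  obtain ⟨L, hL⟩ := lipOn_univ_iff.1 hf (r + ε * R)
  have hθ' := hθ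
  obtain ⟨-, ⟨C, hC⟩, h2⟩ := hθ
  have hC0 : 0 ≤ C := (norm_nonneg _).trans (hC 0)
  refine ⟨⟨L * C * (gaussianEll2 a).real Set.univ, by positivity⟩,
    LipschitzOnWith.of_dist_le_mul fun z hz w hw => ?_⟩
  rw [mem_closedBall_zero_iff] at hz hw
  rw [dist_eq_norm, EllTwo.mollify, EllTwo.mollify,
    ← integral_sub (hf.integrable_mollify hθ' hε a z) (hf.integrable_mollify hθ' hε a w)]
  refine (norm_integral_le_of_norm_le_const (C := L * dist z w * C)
    (Eventually.of_forall fun ζ => ?_)).trans (le_of_eq ?_)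
  · by_cases hζ : R < ‖ζ‖
    · rw [h2 ζ hζ, mul_zero, mul_zero, sub_zero, norm_zero]; positivity
    · rw [← sub_mul, norm_mul]
      refine mul_le_mul ?_ (hC ζ) (norm_nonneg _) (by positivity)
      have := hL.dist_le_mul (z - (ε : ℂ) • ζ)
        (mem_closedBall_zero_iff.2 (norm_sub_smul_le hε hz (not_lt.1 hζ))) (w - (ε : ℂ) • ζ)
        (mem_closedBall_zero_iff.2 (norm_sub_smul_le hε hw (not_lt.1 hζ)))
      rwa [dist_sub_right, dist_eq_norm] at this
  · change _ = (L * C * (gaussianEll2 a).real Set.univ) * dist z w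
    ring

theorem shiftDensity_smul (a : ℝ) (u w : ℂ) (s : ℝ) : shiftDensity a (s * u) w =
    Real.exp (-(s * (w.re * u.re + w.im * u.im) / a ^ 2) -
      s ^ 2 * (u.re ^ 2 + u.im ^ 2) / (2 * a ^ 2)) := by
  simp only [shiftDensity, Complex.re_ofReal_mul, Complex.im_ofReal_mul]
  ring_nf

/-- The logarithmic derivative of the density at `s` is minus the coordinate of the translated point
`ζ + s e`, divided by `a_j²`. Hence the adjoint kernel appears at every `s`, as the dominated
differentiation requires, and not only at `s = 0`. -/
theorem hasDerivAt_translate_mul_shiftDensity {a : ℕ → ℝ} (ha : ∀ i, 0 < a i) {u : ℂ} {j : ℕ}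
    {θ : Ell2 → ℂ} (hθ : ∀ z, HasPartial u j θ z) (ζ : Ell2) (s : ℝ) :
    HasDerivAt (fun s : ℝ => θ (ζ + s • coordVec j u) * (shiftDensity (a j) (s * u) (ζ j) : ℂ))
      (gaussianAdjoint a u j θ (ζ + s • coordVec j u) *
        (shiftDensity (a j) (s * u) (ζ j) : ℂ)) s := by
  have h1 := hasDerivAt_add_smul_of_hasLineDerivAt (fun z => (hθ z).hasLineDerivAt) ζ s
  have h2 : HasDerivAt (fun s : ℝ => shiftDensity (a j) (s * u) (ζ j))
      (shiftDensity (a j) (s * u) (ζ j) *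
        (-(coordRe u j ζ / a j ^ 2) - (2 * s) * (u.re ^ 2 + u.im ^ 2) / (2 * a j ^ 2))) s := by
    simp only [shiftDensity_smul]
    have e : ∀ s : ℝ, s * ((ζ j).re * u.re + (ζ j).im * u.im) = s * coordRe u j ζ := fun _ => rfl
    simp only [e]
    refine HasDerivAt.exp (HasDerivAt.sub (HasDerivAt.neg ?_) ?_)
    · simpa using ((hasDerivAt_id s).mul_const (coordRe u j ζ)).div_const (a j ^ 2)
    · simpa using (((hasDerivAt_id s).pow 2).mul_const (u.re ^ 2 + u.im ^ 2)).div_const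
        (2 * a j ^ 2)
  refine (h1.mul h2.ofReal_comp).congr_deriv ?_
  have ha' : (a j : ℂ) ≠ 0 := by exact_mod_cast (ha j).ne'
  simp only [gaussianAdjoint, Pi.add_apply, Pi.smul_apply, smul_eq_mul, coordRe_add, coordRe_smul,
    coordRe_coordVec_self]
  push_cast
  field_simp
  ring

theorem shiftDensity_le {a : ℝ} {u : ℂ} {j : ℕ} {ζ : Ell2} {s r : ℝ} (hs : |s| ≤ 1)
    (hζ : ‖ζ‖ ≤ r) : shiftDensity a (s * u) (ζ j) ≤ Real.exp (r * ‖u‖ / a ^ 2) := by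
  rw [shiftDensity_smul]
  refine Real.exp_le_exp.2 ?_
  have h1 : 0 ≤ s ^ 2 * (u.re ^ 2 + u.im ^ 2) / (2 * a ^ 2) := by positivity
  have h2 : -(s * coordRe u j ζ) ≤ r * ‖u‖ := by
    refine (neg_le_abs _).trans ?_
    rw [abs_mul]
    calc |s| * |coordRe u j ζ| ≤ 1 * (‖ζ‖ * ‖u‖) :=
          mul_le_mul hs (abs_coordRe_le u j ζ) (abs_nonneg _) zero_le_one
      _ ≤ r * ‖u‖ := by rw [one_mul]; exact mul_le_mul_of_nonneg_right hζ (norm_nonneg _)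
  have h3 := div_le_div_of_nonneg_right h2 (sq_nonneg a)
  rw [neg_div] at h3
  change -(s * coordRe u j ζ / a ^ 2) - _ ≤ _
  linarith

/-- Differentiating a mollification amounts to applying the Gaussian adjoint to its kernel. -/
theorem LipOn.hasLineDerivAt_mollify {f : Ell2 → ℂ} (hf : LipOn Set.univ f) {R : ℝ}
    {θ : Ell2 → ℂ} (hθ : TestFn R 1 θ) {a : ℕ → ℝ} (ha : ∀ i, 0 < a i) {ε : ℝ} (hε : 0 < ε)
    {u : ℂ} (hu : u ∈ ({1, Complex.I} : Set ℂ)) (j : ℕ) (z : Ell2) :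
    HasLineDerivAt ℝ (EllTwo.mollify a θ f ε)
      ((ε : ℂ)⁻¹ * EllTwo.mollify a (gaussianAdjoint a u j θ) f ε z) z (coordVec j u) := by
  set e := coordVec j u with he
  set η := gaussianAdjoint a u j θ with hη
  have hηT : BoundedSupported R η := (hθ.gaussianAdjoint a hu j).boundedSupported
  have hd := (hθ.2 u hu j).1
  set F : ℝ → Ell2 → ℂ := fun s ζ =>
    f (z - (ε : ℂ) • ζ) * (θ (ζ + s • e) * (shiftDensity (a j) (s * u) (ζ j) : ℂ)) with hF
  set F' : ℝ → Ell2 → ℂ := fun s ζ =>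
    f (z - (ε : ℂ) • ζ) * (η (ζ + s • e) * (shiftDensity (a j) (s * u) (ζ j) : ℂ)) with hF'
  have hcont : ∀ {κ : Ell2 → ℂ}, Continuous κ → ∀ s : ℝ, Continuous fun ζ : Ell2 =>
      f (z - (ε : ℂ) • ζ) * (κ (ζ + s • e) * (shiftDensity (a j) (s * u) (ζ j) : ℂ)) := by
    intro κ hκ s
    refine hf.continuous_integrand ((hκ.comp (continuous_add_const _)).mul ?_) ε z
    exact Complex.continuous_ofReal.comp
      ((continuous_shiftDensity _ _).comp (continuous_coord j))
  obtain ⟨-, ⟨C, hC⟩, h2⟩ := hηT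
  have hC0 : 0 ≤ C := (norm_nonneg _).trans (hC 0)
  -- For `|s| < 1`, the translated kernel vanishes unless `‖ζ‖ ≤ R + ‖u‖`; on that ball both `f` and
  -- the density are bounded.
  set r := R + ‖u‖ with hr
  obtain ⟨M, hM0, hM⟩ := hf.bounded (‖z‖ + ε * r)
  have key : HasDerivAt (fun s => ∫ ζ, F s ζ ∂(gaussianEll2 a))
      (∫ ζ, F' 0 ζ ∂(gaussianEll2 a)) 0 := by
    refine (hasDerivAt_integral_of_dominated_loc_of_deriv_le (s := Metric.ball (0 : ℝ) 1)
      (bound := fun _ => M * (C * Real.exp (r * ‖u‖ / a j ^ 2)))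
      (Metric.ball_mem_nhds 0 one_pos)
      (Eventually.of_forall fun s => (hcont hθ.1.1 s).aestronglyMeasurable) ?_
      (hcont (hθ.gaussianAdjoint a hu j).boundedSupported.1 0).aestronglyMeasurable ?_
      (integrable_const _) ?_).2
    · have := hf.integrable_mollify hθ.1 hε.le a z
      refine this.congr (Eventually.of_forall fun ζ => ?_)
      simp [shiftDensity]
    · refine Eventually.of_forall fun ζ s hs => ?_
      rw [mem_ball_zero_iff, Real.norm_eq_abs] at hs
      by_cases hζ : R < ‖ζ + s • e‖
      · simp only [hF', h2 _ hζ, zero_mul, mul_zero, norm_zero]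
        positivity
      · have hζr : ‖ζ‖ ≤ r := by
          have h3 : ‖ζ‖ ≤ ‖ζ + s • e‖ + ‖s • e‖ := by
            simpa using norm_sub_le (ζ + s • e) (s • e)
          have h4 : ‖s • e‖ ≤ ‖u‖ := by
            rw [norm_smul, he, norm_coordVec, Real.norm_eq_abs]
            exact mul_le_of_le_one_left (norm_nonneg _) hs.le
          linarith [not_lt.1 hζ]
        simp only [hF', norm_mul, Complex.norm_real,
          Real.norm_of_nonneg (shiftDensity_nonneg _ _ _)]
        exact mul_le_mul (hM _ (norm_sub_smul_le hε.le le_rfl hζr))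
          (mul_le_mul (hC _) (shiftDensity_le hs.le hζr) (shiftDensity_nonneg _ _ _) hC0)
          (mul_nonneg (norm_nonneg _) (shiftDensity_nonneg _ _ _)) hM0
    · exact Eventually.of_forall fun ζ s _ =>
        (hasDerivAt_translate_mul_shiftDensity ha hd ζ s).const_mul _
  have hF0 : ∫ ζ, F' 0 ζ ∂(gaussianEll2 a) = EllTwo.mollify a η f ε z := by
    refine integral_congr_ae (Eventually.of_forall fun ζ => ?_)
    simp [hF', shiftDensity]
  -- Translating `ζ` by `(t/ε)e` cancels the increment: `z + te - ε(ζ + (t/ε)e) = z - εζ`.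
  have htrans : ∀ t : ℝ, EllTwo.mollify a θ f ε (z + t • e) =
      ∫ ζ, F (t * ε⁻¹) ζ ∂(gaussianEll2 a) := by
    intro t
    rw [EllTwo.mollify, integral_gaussianEll2_translate ha j (((t * ε⁻¹ : ℝ) : ℂ) * u)]
    refine integral_congr_ae (Eventually.of_forall fun ζ => ?_)
    simp only [hF, ← smul_coordVec, ← he, mul_assoc]
    congr 2
    have hs : (ε : ℂ) • ((t * ε⁻¹ : ℝ) • e) = t • e := by
      have hε' : (ε : ℂ) ≠ 0 := by exact_mod_cast hε.ne'
      rw [he, smul_coordVec, smul_coordVec, coordVec, ← lp.single_smul, smul_eq_mul]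
      congr 1
      push_cast
      field_simp
    rw [smul_add, hs]
    abel
  have hlin : HasDerivAt (fun t : ℝ => t * ε⁻¹) ε⁻¹ 0 := by
    simpa using (hasDerivAt_id (0 : ℝ)).mul_const ε⁻¹
  have hcomp := HasDerivAt.scomp (0 : ℝ) (h := fun t : ℝ => t * ε⁻¹)
    (g₁ := fun s => ∫ ζ, F s ζ ∂(gaussianEll2 a)) (g₁' := ∫ ζ, F' 0 ζ ∂(gaussianEll2 a))
    (by simpa using key) hlin
  rw [hF0] at hcomp
  simp only [HasLineDerivAt, htrans]
  simpa [Function.comp_def, Complex.real_smul] using hcomp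


/-! ### Regularity of mollifications -/

theorem LipOn.hasPartial_mollify {f : Ell2 → ℂ} (hf : LipOn Set.univ f) {R : ℝ}
    {θ : Ell2 → ℂ} (hθ : TestFn R 1 θ) {a : ℕ → ℝ} (ha : ∀ i, 0 < a i) {ε : ℝ} (hε : 0 < ε)
    {u : ℂ} (hu : u ∈ ({1, Complex.I} : Set ℂ)) (j : ℕ) (z : Ell2) :
    HasPartial u j (EllTwo.mollify a θ f ε) z :=
  hasPartial_of_hasLineDerivAt (hf.hasLineDerivAt_mollify hθ ha hε hu j z)

theorem LipOn.partialDeriv_mollify {f : Ell2 → ℂ} (hf : LipOn Set.univ f) {R : ℝ}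
    {θ : Ell2 → ℂ} (hθ : TestFn R 1 θ) {a : ℕ → ℝ} (ha : ∀ i, 0 < a i) {ε : ℝ} (hε : 0 < ε)
    {u : ℂ} (hu : u ∈ ({1, Complex.I} : Set ℂ)) (j : ℕ) :
    partialDeriv u j (EllTwo.mollify a θ f ε) =
      (ε : ℂ)⁻¹ • EllTwo.mollify a (gaussianAdjoint a u j θ) f ε :=
  funext fun z => partialDeriv_of_hasLineDerivAt (hf.hasLineDerivAt_mollify hθ ha hε hu j z)

theorem LipOn.contDiffPartial_mollify {f : Ell2 → ℂ} (hf : LipOn Set.univ f) {R : ℝ} {k : ℕ}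
    {θ : Ell2 → ℂ} (hθ : TestFn R k θ) {a : ℕ → ℝ} (ha : ∀ i, 0 < a i) {ε : ℝ} (hε : 0 < ε) :
    ContDiffPartial Set.univ k (EllTwo.mollify a θ f ε) := by
  have hc : Continuous (EllTwo.mollify a θ f ε) :=
    (hf.mollify hθ.boundedSupported hε.le a).continuous
  induction k generalizing θ with
  | zero => exact contDiffPartial_zero.2 hc
  | succ k ih =>
    have h1 : TestFn R 1 θ := by
      refine testFn_succ.2 ⟨hθ.1, fun u hu j => ⟨(hθ.2 u hu j).1, ?_⟩⟩
      exact (hθ.2 u hu j).2.boundedSupported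
    refine contDiffPartial_succ.2 ⟨hc, fun u hu j =>
      ⟨fun z => hf.hasPartial_mollify h1 ha hε hu j z, ?_⟩⟩
    rw [hf.partialDeriv_mollify h1 ha hε hu j]
    have h2 := hθ.gaussianAdjoint a hu j
    have h3 := ih h2 (hf.mollify h2.boundedSupported hε.le a).continuous
    simpa using h3.add_smul (ε : ℂ)⁻¹ 0 h3

/-- A function of class `C¹` that is Lipschitz on bounded sets is in `C^1_F`. -/
theorem LipOn.c1F {g : Ell2 → ℂ} (hg : LipOn Set.univ g) (h1 : ContDiffPartial Set.univ 1 g) :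
    C1F Set.univ g := by
  refine ⟨h1, fun S hS => ?_⟩
  obtain ⟨r, hr⟩ := (uniformlyIncluded_univ.1 hS).subset_closedBall 0
  obtain ⟨M, -, hM⟩ := hg.bounded r
  -- The larger ball is a neighbourhood of each point of `S`.
  obtain ⟨C, hC⟩ := lipOn_univ_iff.1 hg (r + 1)
  refine ⟨M + (C : ℝ) ^ 2, fun z hz => ?_⟩
  have hzr : ‖z‖ ≤ r := mem_closedBall_zero_iff.1 (hr hz)
  set dir : Bool → ℂ := fun b => cond b Complex.I 1 with hdir
  have hmem : ∀ b, dir b ∈ ({1, Complex.I} : Set ℂ) := by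
    rintro (_ | _)
    exacts [one_mem_directions, I_mem_directions]
  have h1' := contDiffPartial_succ.1 h1
  have hsum : ∀ n, ∑ i ∈ Finset.range n ×ˢ (Finset.univ : Finset Bool),
      ‖partialDeriv (dir i.2) i.1 g z‖ ^ 2 ≤ 2 * (C : ℝ) ^ 2 := by
    intro n
    refine sum_sq_norm_lineDeriv_le (ι := ℕ × Bool)
      (g' := fun i => partialDeriv (dir i.2) i.1 g) (v := fun i => coordVec i.1 (dir i.2))
      (fun i z => ((h1'.2 _ (hmem i.2) i.1).1 z).hasLineDerivAt)
      (fun i => contDiffPartial_zero.1 (h1'.2 _ (hmem i.2) i.1).2) _ (fun c => ?_)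
      (closedBall_mem_nhds_of_norm_lt (hzr.trans_lt (lt_add_one r))) hC
    refine le_of_eq ?_
    -- The two real directions at index `j` combine into one complex coordinate, and distinct
    -- indices are orthogonal, so the Bessel hypothesis holds with equality.
    rw [Finset.sum_product, Finset.sum_product]
    have e : ∀ j, ∑ b : Bool, c (j, b) • coordVec j (dir b) =
        coordVec j ((c (j, true) : ℂ) * Complex.I + (c (j, false) : ℂ)) := fun j => by
      simp only [Fintype.sum_bool, hdir, cond_true, cond_false, smul_coordVec, mul_one]
      exact (lp.single_add 2 j _ _).symm
    simp only [e]
    have h2 := lp.norm_sum_single (E := fun _ : ℕ => ℂ) (p := 2) (by norm_num)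
      (fun j => (c (j, true) : ℂ) * Complex.I + (c (j, false) : ℂ)) (Finset.range n)
    simp only [ENNReal.toReal_ofNat, Real.rpow_ofNat] at h2
    rw [h2]
    refine Finset.sum_congr rfl fun j _ => ?_
    rw [← Complex.normSq_eq_norm_sq, Complex.normSq_apply, Fintype.sum_bool]
    simp
    ring
  -- By the parallelogram law, the Wirtinger sum is half the real one, which turns the bound `2C²`
  -- into `C²`.
  have hpar : ∀ j, ‖del j g z‖ ^ 2 + ‖delBar j g z‖ ^ 2 =
      (1 / 2) * ∑ b : Bool, ‖partialDeriv (dir b) j g z‖ ^ 2 := by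
    intro j
    have hp := parallelogram_law_with_norm ℝ (partialDeriv 1 j g z)
      (Complex.I * partialDeriv Complex.I j g z)
    have hn : ‖Complex.I * partialDeriv Complex.I j g z‖ = ‖partialDeriv Complex.I j g z‖ := by
      rw [norm_mul, Complex.norm_I, one_mul]
    rw [hn] at hp
    rw [del, delBar, norm_mul, norm_mul, Fintype.sum_bool]
    simp only [hdir, cond_true, cond_false]
    have : ‖(1 / 2 : ℂ)‖ = 1 / 2 := by norm_num
    rw [this]
    nlinarith [hp]
  have hpart : ∀ n, ∑ j ∈ Finset.range n, (‖del j g z‖ ^ 2 + ‖delBar j g z‖ ^ 2) ≤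
      (C : ℝ) ^ 2 := by
    intro n
    have := hsum n
    rw [Finset.sum_product] at this
    simp only [hpar, ← Finset.mul_sum]
    linarith
  have hnn : ∀ j, 0 ≤ ‖del j g z‖ ^ 2 + ‖delBar j g z‖ ^ 2 := fun j => by positivity
  exact ⟨summable_of_sum_range_le hnn hpart,
    add_le_add (hM z hzr) (Real.tsum_le_of_sum_range_le hnn hpart)⟩

/-! ### Stability of the class of mollifications under differentiation, and the limit -/

/-- Mollifications of `f` with smooth kernels. -/
def IsMollification (a : ℕ → ℝ) (f : Ell2 → ℂ) (ε R : ℝ) (g : Ell2 → ℂ) : Prop :=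
  ∃ θ, (∀ k, TestFn R k θ) ∧ g = mollify a θ f ε

theorem IsMollification.add_smul {a : ℕ → ℝ} {f : Ell2 → ℂ} (hf : LipOn Set.univ f) {ε R : ℝ}
    (hε : 0 ≤ ε) {g h : Ell2 → ℂ} (b c : ℂ) (hg : IsMollification a f ε R g)
    (hh : IsMollification a f ε R h) : IsMollification a f ε R (b • g + c • h) := by
  obtain ⟨θ, hθ, rfl⟩ := hg
  obtain ⟨η, hη, rfl⟩ := hh
  exact ⟨b • θ + c • η, fun k => (hθ k).add_smul b c (hη k),
    (hf.mollify_add_smul (hθ 0) (hη 0) hε a b c).symm⟩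

theorem IsMollification.partialDeriv {a : ℕ → ℝ} (ha : ∀ i, 0 < a i) {f : Ell2 → ℂ}
    (hf : LipOn Set.univ f) {ε R : ℝ} (hε : 0 < ε) {g : Ell2 → ℂ}
    (hg : IsMollification a f ε R g) {u : ℂ} (hu : u ∈ ({1, Complex.I} : Set ℂ)) (j : ℕ) :
    IsMollification a f ε R (partialDeriv u j g) := by
  obtain ⟨θ, hθ, rfl⟩ := hg
  have h : IsMollification a f ε R (mollify a (gaussianAdjoint a u j θ) f ε) :=
    ⟨_, fun k => (hθ (k + 1)).gaussianAdjoint a hu j, rfl⟩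
  rw [hf.partialDeriv_mollify (hθ 1) ha hε hu j]
  simpa using h.add_smul hf hε.le (ε : ℂ)⁻¹ 0 h

theorem IsMollification.del {a : ℕ → ℝ} (ha : ∀ i, 0 < a i) {f : Ell2 → ℂ}
    (hf : LipOn Set.univ f) {ε R : ℝ} (hε : 0 < ε) {g : Ell2 → ℂ}
    (hg : IsMollification a f ε R g) (j : ℕ) : IsMollification a f ε R (del j g) := by
  convert (hg.partialDeriv ha hf hε one_mem_directions j).add_smul hf hε.le (1 / 2)
    (-(1 / 2) * Complex.I) (hg.partialDeriv ha hf hε I_mem_directions j) using 1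
  funext z
  simp only [EllTwo.del, Pi.add_apply, Pi.smul_apply, smul_eq_mul]
  ring

theorem IsMollification.delBar {a : ℕ → ℝ} (ha : ∀ i, 0 < a i) {f : Ell2 → ℂ}
    (hf : LipOn Set.univ f) {ε R : ℝ} (hε : 0 < ε) {g : Ell2 → ℂ}
    (hg : IsMollification a f ε R g) (j : ℕ) : IsMollification a f ε R (delBar j g) := by
  convert (hg.partialDeriv ha hf hε one_mem_directions j).add_smul hf hε.le (1 / 2)
    (1 / 2 * Complex.I) (hg.partialDeriv ha hf hε I_mem_directions j) using 1
  funext z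
  simp only [EllTwo.delBar, Pi.add_apply, Pi.smul_apply, smul_eq_mul]
  ring

theorem multiOp_induction {p : (Ell2 → ℂ) → Prop} {D : ℕ → (Ell2 → ℂ) → Ell2 → ℂ}
    (hD : ∀ j g, p g → p (D j g)) (α : ℕ →₀ ℕ) {g : Ell2 → ℂ} (hg : p g) : p (multiOp D α g) := by
  unfold multiOp
  induction List.range (α.support.sup Nat.succ) with
  | nil => exact hg
  | cons j l ih =>
    rw [List.foldr_cons]
    exact Function.Iterate.rec p ih (fun g hg => hD j g hg) _

theorem IsMollification.c1F {a : ℕ → ℝ} (ha : ∀ i, 0 < a i) {f : Ell2 → ℂ}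
    (hf : LipOn Set.univ f) {ε R : ℝ} (hε : 0 < ε) {g : Ell2 → ℂ}
    (hg : IsMollification a f ε R g) : C1F Set.univ g := by
  obtain ⟨θ, hθ, rfl⟩ := hg
  exact (hf.mollify (hθ 0) hε.le a).c1F (hf.contDiffPartial_mollify (hθ 1) ha hε)

theorem IsMollification.cInftyFInfty {a : ℕ → ℝ} (ha : ∀ i, 0 < a i) {f : Ell2 → ℂ}
    (hf : LipOn Set.univ f) {ε R : ℝ} (hε : 0 < ε) {g : Ell2 → ℂ}
    (hg : IsMollification a f ε R g) : CInftyFInfty Set.univ g := by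
  refine ⟨?_, fun α β => ?_⟩
  · obtain ⟨θ, hθ, rfl⟩ := hg
    exact fun k => hf.contDiffPartial_mollify (hθ k) ha hε
  · refine IsMollification.c1F ha hf hε (R := R) ?_
    exact multiOp_induction (fun j g hg => hg.del ha hf hε j) α
      (multiOp_induction (fun j g hg => hg.delBar ha hf hε j) β hg)

theorem LipOn.tendsto_mollify {f : Ell2 → ℂ} (hf : LipOn Set.univ f) {R : ℝ} {θ : Ell2 → ℂ}
    (hθ : BoundedSupported R θ) (a : ℕ → ℝ) (z : Ell2) :
    Tendsto (fun ε : ℝ => EllTwo.mollify a θ f ε z) (𝓝[>] 0)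
      (𝓝 (f z * ∫ ζ, θ ζ ∂(gaussianEll2 a))) := by
  rw [← integral_const_mul]
  have hθ' := hθ
  obtain ⟨-, ⟨C, hC⟩, h2⟩ := hθ
  have hC0 : 0 ≤ C := (norm_nonneg _).trans (hC 0)
  obtain ⟨M, hM0, hM⟩ := hf.bounded (‖z‖ + |R|)
  refine tendsto_integral_filter_of_dominated_convergence (fun _ => M * C)
    (Eventually.of_forall fun ε => (hf.continuous_integrand hθ'.1 ε z).aestronglyMeasurable)
    ?_ (integrable_const _) (Eventually.of_forall fun ζ => ?_)
  -- Only `ε < 1` matters: then `z - εζ` stays in the fixed ball of radius `‖z‖ + |R|` on the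
  -- support of `θ`.
  · filter_upwards [Ioo_mem_nhdsGT (zero_lt_one (α := ℝ))] with ε hε
    refine Eventually.of_forall fun ζ => ?_
    by_cases hζ : R < ‖ζ‖
    · rw [h2 ζ hζ, mul_zero, norm_zero]; positivity
    · rw [norm_mul]
      refine mul_le_mul (hM _ ?_) (hC ζ) (norm_nonneg _) hM0
      refine (norm_sub_smul_le hε.1.le le_rfl ((not_lt.1 hζ).trans (le_abs_self R))).trans ?_
      have := mul_le_of_le_one_left (abs_nonneg R) hε.2.le
      linarith
  · have hc : Continuous fun ε : ℝ => f (z - (ε : ℂ) • ζ) * θ ζ :=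
      (hf.continuous.comp (continuous_const.sub
        (Complex.continuous_ofReal.smul continuous_const))).mul continuous_const
    have := (hc.tendsto 0).mono_left (nhdsWithin_le_nhds (s := Set.Ioi (0 : ℝ)))
    simpa using this

end EllTwo

end

theorem theorem3p1 (a : ℕ → ℝ) (ha_pos : ∀ i, 0 < a i) (ha_sum : Summable a)
    (ha_lt : ∑' i, a i < 1) (ϑ f : EllTwo.Ell2 → ℂ)
    (hϑ : EllTwo.CInftyZero Set.univ ϑ) (hf : EllTwo.LipOn Set.univ f) :
    (∀ ε : ℝ, 0 < ε →
      (∀ z, Integrable (fun ζ => f (z - (ε : ℂ) • ζ) * ϑ ζ) (EllTwo.gaussianEll2 a)) ∧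
      EllTwo.CInftyFInfty Set.univ (EllTwo.mollify a ϑ f ε)) ∧
    (∫ ζ, ϑ ζ ∂(EllTwo.gaussianEll2 a) = 1 →
      ∀ z, Tendsto (fun ε : ℝ => EllTwo.mollify a ϑ f ε z) (𝓝[>] 0) (𝓝 (f z))) := by
  obtain ⟨R, hR⟩ := hϑ.exists_testFn
  refine ⟨fun ε hε => ⟨hf.integrable_mollify (hR 0) hε.le a, ?_⟩, fun h1 z => ?_⟩
  · exact EllTwo.IsMollification.cInftyFInfty ha_pos hf hε ⟨ϑ, hR, rfl⟩
  · simpa [h1] using hf.tendsto_mollify (hR 0) a z
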